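/- Let $n\ge 1$ with $2n+1>3$, let $\alpha\in\mathbb R$, and let $(M^{2n+1},\phi,\xi,\eta,g)$ be a smooth almost contact metric manifold, i.e. $\phi$ is a smooth field of endomorphisms of the tangent spaces, $\xi$ a smooth vector field, $\eta$ a smooth $1$-form and $g$ a smooth Riemannian metric with $\phi^2=-I+\eta\otimes\xi$, $\eta(\xi)=1$ and $g(\phi X,\phi Y)=g(X,Y)-\eta(X)\eta(Y)$. Put $\Phi(X,Y)=g(\phi X,Y)$ and $h=\tfrac12\mathcal L_\xi\phi$, and let $R(X,Y)=[\nabla_X,\nabla_Y]-\nabla_{[X,Y]}$ be the curvature tensor of the Levi-Civita connection $\nabla$ of $g$. Suppose that the structure is almost $\alpha$-cosymplectic, i.e. $$d\eta=0,\qquad d\Phi=2\alpha\,\eta\wedge\Phi ,$$ and that there are smooth functions $\kappa,\mu,\nu:M\to\mathbb R$ (not assumed constant, and with no condition on their differentials) such that for all vector fields $X,Y$ $$R(X,Y)\xi=\eta(Y)(\kappa I+\mu h+\nu\phi h)X-\eta(X)(\kappa I+\mu h+\nu\phi h)Y .$$ Let $\mathcal R_\eta(M)$ be the subring of the ring of smooth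 functions $f$ on $M$ with $df\wedge\eta=0$. Then $\kappa\in\mathcal R_\eta(M)$. If moreover $h$ does not vanish identically on any connected component of $M$ (so that $\mu$ and $\nu$ really occur in the condition), then also $\mu\in\mathcal R_\eta(M)$ and $\nu\in\mathcal R_\eta(M)$. -/

import Mathlib

open Bundle Manifold VectorField
open scoped ContDiff

noncomputable section

namespace AlmostCosymplectic

/-! ### The Levi-Civita connection and the curvature of a smooth Riemannian metric -/

section LeviCivita

variable {E : Type*} [NormedAddCommGroup E] [NormedSpace ℝ E]
  {M : Type*} [TopologicalSpace M] [ChartedSpace E M]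

/-- The derivative `X(f)` of a real function along a vector field. -/
def dirDeriv (X : Π x : M, TangentSpace 𝓘(ℝ, E) x) (f : M → ℝ) (x : M) : ℝ :=
  mvfderiv 𝓘(ℝ, E) f x (X x)

variable [IsManifold 𝓘(ℝ, E) ∞ M]

/-- A smooth vector field on `M`. -/
def IsSmoothVF (X : Π x : M, TangentSpace 𝓘(ℝ, E) x) : Prop :=
  ContMDiff 𝓘(ℝ, E) (𝓘(ℝ, E).prod 𝓘(ℝ, E)) ∞ (fun x => TotalSpace.mk' E x (X x))

variable (g : ContMDiffRiemannianMetric 𝓘(ℝ, E) ∞ E (fun x : M => TangentSpace 𝓘(ℝ, E) x))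

/-- The function `g(X, Y)` of two vector fields. -/
def metric (X Y : Π x : M, TangentSpace 𝓘(ℝ, E) x) (x : M) : ℝ := g.inner x (X x) (Y x)

/-- The right-hand side of the Koszul formula for `2 g(∇_X Y, Z)`. -/
def koszul (X Y Z : Π x : M, TangentSpace 𝓘(ℝ, E) x) (x : M) : ℝ :=
  dirDeriv X (metric g Y Z) x + dirDeriv Y (metric g Z X) x - dirDeriv Z (metric g X Y) x
    + g.inner x (mlieBracket 𝓘(ℝ, E) X Y x) (Z x)
    - g.inner x (mlieBracket 𝓘(ℝ, E) Y Z x) (X x)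
    + g.inner x (mlieBracket 𝓘(ℝ, E) Z X x) (Y x)

variable {g} {X X' Y Y' Z Z' : Π x : M, TangentSpace 𝓘(ℝ, E) x} {f : M → ℝ} {x : M}

lemma metric_mdiff (hX : MDiffAt (T% X) x) (hY : MDiffAt (T% Y) x) :
    MDiffAt (metric g X Y) x := by
  have : MDifferentiableAt 𝓘(ℝ, E) (𝓘(ℝ, E).prod 𝓘(ℝ))
      (fun m ↦ TotalSpace.mk' ℝ (E := Bundle.Trivial M ℝ) m (g.inner m (X m) (Y m))) x := by
    apply MDifferentiableAt.clm_bundle_apply₂ (F₁ := E) (F₂ := E)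
    · exact g.contMDiff.mdifferentiableAt (by simp)
    · exact hX
    · exact hY
  simp only [mdifferentiableAt_totalSpace] at this
  exact this.2

lemma metric_comm : metric g X Y = metric g Y X := funext fun _ => g.symm _ _ _

lemma metric_add_left : metric g (X + X') Y = metric g X Y + metric g X' Y := by
  ext; simp [metric]

lemma metric_add_right : metric g X (Y + Y') = metric g X Y + metric g X Y' := by
  ext; simp [metric]

lemma metric_smul_left : metric g (f • X) Y = f * metric g X Y := by
  ext; simp [metric]

lemma metric_smul_right : metric g X (f • Y) = f * metric g X Y := by
  ext; simp [metric]

lemma eq_of_inner_eq {u v : TangentSpace 𝓘(ℝ, E) x}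
    (h : ∀ w, g.inner x u w = g.inner x v w) : u = v := by
  by_contra hne
  have h1 := g.pos x (u - v) (sub_ne_zero.mpr hne)
  have h2 := h (u - v)
  simp only [map_sub] at h1 h2
  simp at h1 h2
  linarith

variable [CompleteSpace E]

lemma koszul_tensorial_left (hY : MDiffAt (T% Y) x) (hZ : MDiffAt (T% Z) x) :
    TensorialAt 𝓘(ℝ, E) E (fun X => koszul g X Y Z x) x where
  smul {f X} hf hX := by
    have h1 := mlieBracket_smul_left (W := Y) hf hX
    have h2 := mlieBracket_smul_right (V := Z) hf hX
    simp only [koszul, dirDeriv, metric_smul_left, metric_smul_right,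
      mvfderiv_mul hf (metric_mdiff hZ hX), mvfderiv_mul hf (metric_mdiff hX hY), h1, h2]
    simp [metric, g.symm x (Z x)]
    ring
  add {X X'} hX hX' := by
    have h1 := mlieBracket_add_left (W := Y) hX hX'
    have h2 := mlieBracket_add_right (V := Z) hX hX'
    simp only [koszul, dirDeriv, metric_add_left, metric_add_right,
      mvfderiv_add (metric_mdiff hZ hX) (metric_mdiff hZ hX'),
      mvfderiv_add (metric_mdiff hX hY) (metric_mdiff hX' hY), h1, h2]
    simp
    ring

lemma koszul_tensorial_right (hX : MDiffAt (T% X) x) (hY : MDiffAt (T% Y) x) :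
    TensorialAt 𝓘(ℝ, E) E (fun Z => koszul g X Y Z x) x where
  smul {f Z} hf hZ := by
    have h1 := mlieBracket_smul_right (V := Y) hf hZ
    have h2 := mlieBracket_smul_left (W := X) hf hZ
    simp only [koszul, dirDeriv, metric_smul_left, metric_smul_right,
      mvfderiv_mul hf (metric_mdiff hZ hX), mvfderiv_mul hf (metric_mdiff hY hZ), h1, h2]
    simp [metric, g.symm x (Z x)]
    ring
  add {Z Z'} hZ hZ' := by
    have h1 := mlieBracket_add_right (V := Y) hZ hZ'
    have h2 := mlieBracket_add_left (W := X) hZ hZ'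
    simp only [koszul, dirDeriv, metric_add_left, metric_add_right,
      mvfderiv_add (metric_mdiff hZ hX) (metric_mdiff hZ' hX),
      mvfderiv_add (metric_mdiff hY hZ) (metric_mdiff hY hZ'), h1, h2]
    simp
    ring

lemma koszul_add_mid (hX : MDiffAt (T% X) x) (hY : MDiffAt (T% Y) x) (hY' : MDiffAt (T% Y') x)
    (hZ : MDiffAt (T% Z) x) :
    koszul g X (Y + Y') Z x = koszul g X Y Z x + koszul g X Y' Z x := by
  have h1 := mlieBracket_add_right (V := X) hY hY'
  have h2 := mlieBracket_add_left (W := Z) hY hY'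
  simp only [koszul, dirDeriv, metric_add_left, metric_add_right,
    mvfderiv_add (metric_mdiff hY hZ) (metric_mdiff hY' hZ),
    mvfderiv_add (metric_mdiff hX hY) (metric_mdiff hX hY'), h1, h2]
  simp
  ring

lemma koszul_smul_mid (hf : MDiffAt f x) (hX : MDiffAt (T% X) x) (hY : MDiffAt (T% Y) x)
    (hZ : MDiffAt (T% Z) x) :
    koszul g X (f • Y) Z x =
      f x * koszul g X Y Z x + 2 * dirDeriv X f x * g.inner x (Y x) (Z x) := by
  have h1 := mlieBracket_smul_right (V := X) hf hY
  have h2 := mlieBracket_smul_left (W := Z) hf hY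
  simp only [koszul, dirDeriv, metric_smul_left, metric_smul_right,
    mvfderiv_mul hf (metric_mdiff hY hZ), mvfderiv_mul hf (metric_mdiff hX hY), h1, h2]
  simp [metric, g.symm x (X x)]
  ring

variable [FiniteDimensional ℝ E]

variable (g) in
/-- The isomorphism `v ↦ g(v, ·)` from a tangent space to its dual. -/
def flat (x : M) : TangentSpace 𝓘(ℝ, E) x ≃ₗ[ℝ] (TangentSpace 𝓘(ℝ, E) x →L[ℝ] ℝ) :=
  haveI : FiniteDimensional ℝ (TangentSpace 𝓘(ℝ, E) x) :=
    inferInstanceAs (FiniteDimensional ℝ E)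
  haveI : T2Space (TangentSpace 𝓘(ℝ, E) x) := inferInstanceAs (T2Space E)
  LinearEquiv.ofBijective (g.inner x).toLinearMap <| by
    have hinj : Function.Injective (g.inner x).toLinearMap := fun u v huv =>
      eq_of_inner_eq (g := g) fun w => congrArg (fun L => L w) huv
    let D := LinearMap.toContinuousLinearMap (𝕜 := ℝ) (E := TangentSpace 𝓘(ℝ, E) x) (F' := ℝ)
    refine ⟨hinj, ?_⟩
    have h2 : Function.Injective (D.symm.toLinearMap ∘ₗ (g.inner x).toLinearMap) :=
      D.symm.injective.comp hinj
    have h3 := (LinearMap.injective_iff_surjective_of_finrank_eq_finrank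
      (Subspace.dual_finrank_eq (K := ℝ) (V := TangentSpace 𝓘(ℝ, E) x)).symm).mp h2
    intro L
    obtain ⟨v, hv⟩ := h3 (D.symm L)
    exact ⟨v, D.symm.injective hv⟩

@[simp] lemma flat_apply (v w : TangentSpace 𝓘(ℝ, E) x) : flat g x v w = g.inner x v w := rfl

open Classical in
variable (g) in
/-- `leviCivitaFun g Y x v` is `(∇_v Y)(x)`, the vector with `2 g(∇_X Y, Z) = koszul X Y Z`
(and zero where `Y` is not differentiable). -/
def leviCivitaFun (Y : Π x : M, TangentSpace 𝓘(ℝ, E) x) (x : M) :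
    TangentSpace 𝓘(ℝ, E) x →L[ℝ] TangentSpace 𝓘(ℝ, E) x :=
  haveI : FiniteDimensional ℝ (TangentSpace 𝓘(ℝ, E) x) :=
    inferInstanceAs (FiniteDimensional ℝ E)
  haveI : T2Space (TangentSpace 𝓘(ℝ, E) x) := inferInstanceAs (T2Space E)
  if hY : MDiffAt (T% Y) x then
    LinearMap.toContinuousLinearMap ((2⁻¹ : ℝ) • ((flat g x).symm.toLinearMap ∘ₗ
      (TensorialAt.mkHom₂ (I := 𝓘(ℝ, E)) (F := E) (F' := E) (fun X Z => koszul g X Y Z x) x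
        (fun _ hZ => koszul_tensorial_left hY hZ)
        (fun _ hX => koszul_tensorial_right hX hY)).toLinearMap))
  else 0

lemma leviCivitaFun_spec (hX : MDiffAt (T% X) x) (hY : MDiffAt (T% Y) x)
    (hZ : MDiffAt (T% Z) x) :
    2 * g.inner x (leviCivitaFun g Y x (X x)) (Z x) = koszul g X Y Z x := by
  have key := TensorialAt.mkHom₂_apply (I := 𝓘(ℝ, E)) (F := E) (F' := E)
    (Φ := fun X Z => koszul g X Y Z x) (x := x)
    (fun _ hZ => koszul_tensorial_left hY hZ) (fun _ hX => koszul_tensorial_right hX hY) hX hZ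
  rw [← flat_apply, ← key]
  simp [leviCivitaFun, hY, -flat_apply]

lemma leviCivitaFun_spec_extend (hY : MDiffAt (T% Y) x) (v w : TangentSpace 𝓘(ℝ, E) x) :
    2 * g.inner x (leviCivitaFun g Y x v) w =
      koszul g (FiberBundle.extend E v) Y (FiberBundle.extend E w) x := by
  rw [← leviCivitaFun_spec (FiberBundle.mdifferentiableAt_extend ..) hY
    (FiberBundle.mdifferentiableAt_extend ..)]
  simp

variable (g) in
/-- The Levi-Civita connection of `g`; `leviCivita g Y x (X x)` is `(∇_X Y)(x)`. -/
def leviCivita : CovariantDerivative 𝓘(ℝ, E) E (fun x : M => TangentSpace 𝓘(ℝ, E) x) where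
  toFun := leviCivitaFun g
  isCovariantDerivativeOnUniv :=
    { add := fun {Y Y' x} hY hY' _ => by
        ext1 v
        apply eq_of_inner_eq (g := g)
        intro w
        have h0 := leviCivitaFun_spec_extend (g := g) (mdifferentiableAt_add_section hY hY') v w
        have h1 := leviCivitaFun_spec_extend (g := g) hY v w
        have h2 := leviCivitaFun_spec_extend (g := g) hY' v w
        have h3 := koszul_add_mid (g := g) (FiberBundle.mdifferentiableAt_extend 𝓘(ℝ, E) E v)
          hY hY' (FiberBundle.mdifferentiableAt_extend 𝓘(ℝ, E) E w)
        rw [← h0, ← h1, ← h2] at h3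
        simp only [add_apply, map_add] at h3 ⊢
        linarith
      leibniz := fun {Y f x} hY hf _ => by
        ext1 v
        apply eq_of_inner_eq (g := g)
        intro w
        have h0 := leviCivitaFun_spec_extend (g := g) (hf.smul_section hY) v w
        have h1 := leviCivitaFun_spec_extend (g := g) hY v w
        have h3 := koszul_smul_mid (g := g) hf (FiberBundle.mdifferentiableAt_extend 𝓘(ℝ, E) E v)
          hY (FiberBundle.mdifferentiableAt_extend 𝓘(ℝ, E) E w)
        rw [← h1, ← h0] at h3
        simp [dirDeriv] at h3 ⊢
        linarith }

/-- The Levi-Civita connection has no torsion. -/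
lemma leviCivita_torsion (hX : MDiffAt (T% X) x) (hY : MDiffAt (T% Y) x) :
    leviCivita g Y x (X x) - leviCivita g X x (Y x) = mlieBracket 𝓘(ℝ, E) X Y x := by
  apply eq_of_inner_eq (g := g)
  intro w
  have hw := FiberBundle.mdifferentiableAt_extend 𝓘(ℝ, E) E w
  have h1 := leviCivitaFun_spec (g := g) hX hY hw
  have h2 := leviCivitaFun_spec (g := g) hY hX hw
  simp only [koszul, metric_comm (X := FiberBundle.extend E w), metric_comm (X := Y) (Y := X),
    mlieBracket_swap_apply (V := FiberBundle.extend E w),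
    mlieBracket_swap_apply (V := Y) (W := X), FiberBundle.extend_apply_self] at h1 h2
  change g.inner x (leviCivitaFun g Y x (X x) - leviCivitaFun g X x (Y x)) w = _
  simp at h1 h2 ⊢
  linarith

/-- The Levi-Civita connection is compatible with the metric. -/
lemma leviCivita_metric (hX : MDiffAt (T% X) x) (hY : MDiffAt (T% Y) x) (hZ : MDiffAt (T% Z) x) :
    dirDeriv X (metric g Y Z) x =
      g.inner x (leviCivita g Y x (X x)) (Z x) + g.inner x (Y x) (leviCivita g Z x (X x)) := by
  have h1 := leviCivitaFun_spec (g := g) hX hY hZ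
  have h2 := leviCivitaFun_spec (g := g) hX hZ hY
  rw [g.symm x (Y x)]
  simp only [koszul, metric_comm (X := Z), metric_comm (X := Y) (Y := X),
    mlieBracket_swap_apply (V := Z), mlieBracket_swap_apply (V := Y) (W := X)] at h1 h2
  change _ = g.inner x (leviCivitaFun g Y x (X x)) (Z x) +
    g.inner x (leviCivitaFun g Z x (X x)) (Y x)
  simp at h1 h2 ⊢
  linarith

variable (g) in
/-- The vector field `∇_X Y`. -/
def nabla (X Y : Π x : M, TangentSpace 𝓘(ℝ, E) x) : Π x : M, TangentSpace 𝓘(ℝ, E) x :=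
  fun x => leviCivita g Y x (X x)

variable (g) in
/-- The curvature `R(X, Y)Z = ∇_X ∇_Y Z - ∇_Y ∇_X Z - ∇_{[X, Y]} Z`. -/
def curvature (X Y Z : Π x : M, TangentSpace 𝓘(ℝ, E) x) : Π x : M, TangentSpace 𝓘(ℝ, E) x :=
  nabla g X (nabla g Y Z) - nabla g Y (nabla g X Z) - nabla g (mlieBracket 𝓘(ℝ, E) X Y) Z

end LeviCivita

/-! ### Exterior calculus in low degrees -/

section Forms

variable {E : Type*} [NormedAddCommGroup E] [NormedSpace ℝ E]
  {M : Type*} [TopologicalSpace M] [ChartedSpace E M]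

/-- `dη(X, Y) = X(η(Y)) - Y(η(X)) - η([X, Y])` for a 1-form `η`. -/
def extDerivOne (η : Π x : M, TangentSpace 𝓘(ℝ, E) x →L[ℝ] ℝ)
    (X Y : Π x : M, TangentSpace 𝓘(ℝ, E) x) (x : M) : ℝ :=
  dirDeriv X (fun y => η y (Y y)) x - dirDeriv Y (fun y => η y (X y)) x
    - η x (mlieBracket 𝓘(ℝ, E) X Y x)

/-- `dΦ(X, Y, Z)`, the cyclic sum of `X(Φ(Y, Z)) - Φ([X, Y], Z)`, for a 2-form `Φ`. -/
def extDerivTwo (Φ : Π x : M, TangentSpace 𝓘(ℝ, E) x → TangentSpace 𝓘(ℝ, E) x → ℝ)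
    (X Y Z : Π x : M, TangentSpace 𝓘(ℝ, E) x) (x : M) : ℝ :=
  dirDeriv X (fun y => Φ y (Y y) (Z y)) x + dirDeriv Y (fun y => Φ y (Z y) (X y)) x
    + dirDeriv Z (fun y => Φ y (X y) (Y y)) x
    - Φ x (mlieBracket 𝓘(ℝ, E) X Y x) (Z x) - Φ x (mlieBracket 𝓘(ℝ, E) Y Z x) (X x)
    - Φ x (mlieBracket 𝓘(ℝ, E) Z X x) (Y x)

/-- `(η ∧ Φ)(u, v, w)` at a point, for a 1-form `η` and a 2-form `Φ`, in the same
normalization as `extDerivTwo`. -/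
def wedgeOneTwo (η : Π x : M, TangentSpace 𝓘(ℝ, E) x →L[ℝ] ℝ)
    (Φ : Π x : M, TangentSpace 𝓘(ℝ, E) x → TangentSpace 𝓘(ℝ, E) x → ℝ)
    (x : M) (u v w : TangentSpace 𝓘(ℝ, E) x) : ℝ :=
  η x u * Φ x v w + η x v * Φ x w u + η x w * Φ x u v

/-- `(θ ∧ η)(u, v)` at a point, for 1-forms `θ` and `η`. -/
def wedgeOneOne (θ η : Π x : M, TangentSpace 𝓘(ℝ, E) x →L[ℝ] ℝ)
    (x : M) (u v : TangentSpace 𝓘(ℝ, E) x) : ℝ :=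
  θ x u * η x v - θ x v * η x u

/-- `R_η(M)`: the subring of the ring of smooth functions `f` on `M` with `df ∧ η = 0`. -/
def etaRing (η : Π x : M, TangentSpace 𝓘(ℝ, E) x →L[ℝ] ℝ) :
    Subring C^∞⟮𝓘(ℝ, E), M; 𝓘(ℝ, ℝ), ℝ⟯ where
  carrier := {f | ∀ (x : M) (u v : TangentSpace 𝓘(ℝ, E) x),
    wedgeOneOne (mvfderiv 𝓘(ℝ, E) f) η x u v = 0}
  zero_mem' := fun x u v => by
    have : mvfderiv 𝓘(ℝ, E) (⇑(0 : C^∞⟮𝓘(ℝ, E), M; 𝓘(ℝ, ℝ), ℝ⟯)) x = 0 := mvfderiv_const 0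
    simp only [wedgeOneOne, this]
    simp
  one_mem' := fun x u v => by
    have : mvfderiv 𝓘(ℝ, E) (⇑(1 : C^∞⟮𝓘(ℝ, E), M; 𝓘(ℝ, ℝ), ℝ⟯)) x = 0 := mvfderiv_const 1
    simp only [wedgeOneOne, this]
    simp
  add_mem' := fun {a b} ha hb x u v => by
    have h : mvfderiv 𝓘(ℝ, E) (⇑(a + b)) x = mvfderiv 𝓘(ℝ, E) a x + mvfderiv 𝓘(ℝ, E) b x :=
      mvfderiv_add (a.contMDiff.mdifferentiableAt (by simp))
        (b.contMDiff.mdifferentiableAt (by simp))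
    have h1 := ha x u v
    have h2 := hb x u v
    simp only [wedgeOneOne, h, add_apply] at h1 h2 ⊢
    linarith
  neg_mem' := fun {a} ha x u v => by
    have h : mvfderiv 𝓘(ℝ, E) (⇑(-a)) x = - mvfderiv 𝓘(ℝ, E) a x := mvfderiv_neg
    have h1 := ha x u v
    simp only [wedgeOneOne, h, neg_apply] at h1 ⊢
    linarith
  mul_mem' := fun {a b} ha hb x u v => by
    have h : mvfderiv 𝓘(ℝ, E) (⇑(a * b)) x =
        a x • mvfderiv 𝓘(ℝ, E) b x + b x • mvfderiv 𝓘(ℝ, E) a x :=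
      mvfderiv_mul (a.contMDiff.mdifferentiableAt (by simp))
        (b.contMDiff.mdifferentiableAt (by simp))
    have h1 := ha x u v
    have h2 := hb x u v
    simp only [wedgeOneOne, h, add_apply, smul_apply, smul_eq_mul] at h1 h2 ⊢
    linear_combination b x * h1 + a x * h2

end Forms

/-! ### Almost contact metric structures -/

section Structures

variable (E : Type*) [NormedAddCommGroup E] [NormedSpace ℝ E]
  (M : Type*) [TopologicalSpace M] [ChartedSpace E M] [IsManifold 𝓘(ℝ, E) ∞ M]

/-- A (smooth) almost contact metric structure `(φ, ξ, η, g)` on `M`. -/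
structure AlmostContactMetricStructure where
  /-- the field of endomorphisms of the tangent spaces -/
  φ : Π x : M, TangentSpace 𝓘(ℝ, E) x →L[ℝ] TangentSpace 𝓘(ℝ, E) x
  /-- the characteristic vector field -/
  ξ : Π x : M, TangentSpace 𝓘(ℝ, E) x
  /-- the 1-form -/
  η : Π x : M, TangentSpace 𝓘(ℝ, E) x →L[ℝ] ℝ
  /-- the compatible Riemannian metric -/
  g : ContMDiffRiemannianMetric 𝓘(ℝ, E) ∞ E (fun x : M => TangentSpace 𝓘(ℝ, E) x)
  smooth_φ : ContMDiff 𝓘(ℝ, E) (𝓘(ℝ, E).prod 𝓘(ℝ, E →L[ℝ] E)) ∞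
    (fun x => TotalSpace.mk' (E →L[ℝ] E)
      (E := fun x : M => TangentSpace 𝓘(ℝ, E) x →L[ℝ] TangentSpace 𝓘(ℝ, E) x) x (φ x))
  smooth_ξ : IsSmoothVF ξ
  smooth_η : ContMDiff 𝓘(ℝ, E) (𝓘(ℝ, E).prod 𝓘(ℝ, E →L[ℝ] ℝ)) ∞
    (fun x => TotalSpace.mk' (E →L[ℝ] ℝ)
      (E := fun x : M => TangentSpace 𝓘(ℝ, E) x →L[ℝ] Bundle.Trivial M ℝ x) x (η x))
  φ_sq : ∀ (x : M) (v : TangentSpace 𝓘(ℝ, E) x), φ x (φ x v) = -v + η x v • ξ x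
  η_ξ : ∀ x : M, η x (ξ x) = 1
  compatible : ∀ (x : M) (u v : TangentSpace 𝓘(ℝ, E) x),
    g.inner x (φ x u) (φ x v) = g.inner x u v - η x u * η x v

namespace AlmostContactMetricStructure

variable {E M} (S : AlmostContactMetricStructure E M)

/-- The fundamental 2-form `Φ(u, v) = g(φ u, v)`. -/
def fundamentalForm (x : M) (u v : TangentSpace 𝓘(ℝ, E) x) : ℝ := S.g.inner x (S.φ x u) v

/-- `(φ, ξ, η, g)` is almost `α`-cosymplectic: `dη = 0` and `dΦ = 2 α η ∧ Φ`. -/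
def IsAlmostCosymplectic (α : ℝ) : Prop :=
  (∀ X Y : Π x : M, TangentSpace 𝓘(ℝ, E) x, IsSmoothVF X → IsSmoothVF Y →
    ∀ x, extDerivOne S.η X Y x = 0) ∧
  (∀ X Y Z : Π x : M, TangentSpace 𝓘(ℝ, E) x, IsSmoothVF X → IsSmoothVF Y → IsSmoothVF Z →
    ∀ x, extDerivTwo S.fundamentalForm X Y Z x =
      2 * α * wedgeOneTwo S.η S.fundamentalForm x (X x) (Y x) (Z x))

/-- The Lie derivative `(L_ξ φ)X = [ξ, φ X] - φ [ξ, X]`. -/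
def lieDerivPhi (X : Π x : M, TangentSpace 𝓘(ℝ, E) x) (x : M) : TangentSpace 𝓘(ℝ, E) x :=
  mlieBracket 𝓘(ℝ, E) S.ξ (fun y => S.φ y (X y)) x - S.φ x (mlieBracket 𝓘(ℝ, E) S.ξ X x)

lemma φ_mdiff {X : Π x : M, TangentSpace 𝓘(ℝ, E) x} {x : M} (hX : MDiffAt (T% X) x) :
    MDiffAt (T% (fun y => S.φ y (X y))) x :=
  MDifferentiableAt.clm_bundle_apply (F₁ := E) (F₂ := E)
    (S.smooth_φ.mdifferentiableAt (by simp)) hX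

lemma lieDerivPhi_tensorial [CompleteSpace E] (x : M) :
    TensorialAt 𝓘(ℝ, E) E (fun X => S.lieDerivPhi X x) x where
  smul {f X} hf hX := by
    have h1 := mlieBracket_smul_right (V := S.ξ) hf (S.φ_mdiff hX)
    have h2 := mlieBracket_smul_right (V := S.ξ) hf hX
    have h3 : (fun y => S.φ y ((f • X) y)) = f • (fun y => S.φ y (X y)) := by
      ext y; simp
    simp only [lieDerivPhi, h3, h1, h2]
    simp only [map_add, map_smul]
    module
  add {X X'} hX hX' := by
    have h1 := mlieBracket_add_right (V := S.ξ) (S.φ_mdiff hX) (S.φ_mdiff hX')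
    have h2 := mlieBracket_add_right (V := S.ξ) hX hX'
    have h3 : (fun y => S.φ y ((X + X') y)) =
        (fun y => S.φ y (X y)) + (fun y => S.φ y (X' y)) := by
      ext y; simp
    simp only [lieDerivPhi, h3, h1, h2]
    simp only [map_add]
    abel

variable [FiniteDimensional ℝ E] [CompleteSpace E]

/-- The tensor field `h = (1/2) L_ξ φ`. -/
def h (x : M) : TangentSpace 𝓘(ℝ, E) x →L[ℝ] TangentSpace 𝓘(ℝ, E) x :=
  (2⁻¹ : ℝ) • TensorialAt.mkHom (I := 𝓘(ℝ, E)) (F := E) (fun X => S.lieDerivPhi X x) x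
    (S.lieDerivPhi_tensorial x)

lemma h_apply {X : Π x : M, TangentSpace 𝓘(ℝ, E) x} {x : M} (hX : MDiffAt (T% X) x) :
    S.h x (X x) = (2⁻¹ : ℝ) • S.lieDerivPhi X x := by
  simp only [h, smul_apply, TensorialAt.mkHom_apply (S.lieDerivPhi_tensorial x) hX]

/-- The `(κ, μ, ν)`-nullity condition
`R(X, Y)ξ = η(Y)(κ I + μ h + ν φ h)X - η(X)(κ I + μ h + ν φ h)Y`. -/
def NullityCondition (κ μ ν : M → ℝ) : Prop :=
  ∀ X Y : Π x : M, TangentSpace 𝓘(ℝ, E) x, IsSmoothVF X → IsSmoothVF Y → ∀ x,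
    curvature S.g X Y S.ξ x =
      S.η x (Y x) • (κ x • X x + μ x • S.h x (X x) + ν x • S.φ x (S.h x (X x)))
      - S.η x (X x) • (κ x • Y x + μ x • S.h x (Y x) + ν x • S.φ x (S.h x (Y x)))

end AlmostContactMetricStructure

end Structures

end AlmostCosymplectic

/-!
# The nullity functions of an almost cosymplectic `(κ, μ, ν)`-space are constant along the leaves

Since `dη = 0`, the distribution `η = 0` is integrable.  Write `∇ξ = α (I - η ⊗ ξ) + B`.  The
component of `dΦ = 2α η ∧ Φ` along `ξ` forces `∇_ξ φ = 0` and `φ B = -B φ`; hence `B` is symmetric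
with trace zero and `h = φ B`.  Splitting the nullity condition for `R(X, ξ)ξ` into the parts
commuting and anticommuting with `φ` gives, with `σ = -(κ + α²)`,
`B² = σ (I - η ⊗ ξ)` and `∇_ξ B = (ν - 2α) B - μ φ B`,
and for `X`, `Y` tangent to the leaves the condition says that `B` is a Codazzi tensor on the
leaves.

*The function `κ`.*  The trilinear form `g((∇_X B)Y, Z)` is totally symmetric on a leaf, and
differentiating `B² = σ I` determines it in terms of `dσ` and `B`
(`Nullity.D_sigma_identity`).  This is the fact that an eigenvalue of multiplicity at least two of a
Codazzi tensor is constant along its eigenspaces; taking a trace (`linearForm_comp_eq_zero`) yields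
`(3 - dim M) σ dσ = 0` along the leaves.  Where `σ = 0`, also `B = 0`, and
differentiating `g(BY, BY) = σ g(Y, Y)` gives `dσ = 0` there too.

*The functions `μ` and `ν`.*  Now `dσ = 2 (ν - 2α) σ η`, so `σ` vanishes identically on a component
or nowhere on it (`isOpen_setOf_eq_zero`); the assumption on `h` excludes the first case.  With
`σ` constant on the leaves and nonzero, the symmetries of `∇B` and `∇φ` make both vanish along the
leaves (`Nullity.tracefree_parallel`, `Nullity.φ_parallel`).  By the pair symmetry of the curvature,
the nullity condition also gives `g(R(X, ξ)Y, Z) = 0` for `X`, `Y`, `Z` tangent to the leaves,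
so the Ricci identity for `B` in the directions `X`, `ξ` reduces to `dν(X) B - dμ(X) φ B = 0`
(`Nullity.ricci_identity`).  As `B` and `φ B` are linearly independent, `dμ` and `dν` vanish along
the leaves.

All of these computations use only the ring of smooth functions, the module of smooth vector fields
over it, and the formal properties of the Levi-Civita connection.  They are therefore carried out
for an abstract `LeviCivitaCalculus`, of which the manifold provides an instance once the
Levi-Civita connection is known to preserve smoothness (`IsSmoothVF.nabla`).
-/

namespace AlmostCosymplectic

/-! ### Algebraic Levi-Civita calculus -/

/-- The algebra of a Riemannian metric and its Levi-Civita connection `conn`, with the vector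
fields `V` regarded as a module over the ring `F` of functions.  The Lie bracket is not a separate
datum: having no torsion, the connection determines it as `conn X Y - conn Y X`. -/
structure LeviCivitaCalculus (F V : Type*) [CommRing F] [AddCommGroup V] [Module F V] where
  /-- the derivative of a function along a vector field -/
  D : V →ₗ[F] Derivation ℤ F F
  /-- the metric -/
  g : V →ₗ[F] V →ₗ[F] F
  /-- the connection -/
  conn : V →ₗ[F] V →+ V
  double_eq_zero : ∀ a : F, 2 * a = 0 → a = 0
  g_symm : ∀ X Y, g X Y = g Y X
  g_definite : ∀ X, g X X = 0 → X = 0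
  conn_smul : ∀ X (a : F) Y, conn X (a • Y) = a • conn X Y + D X a • Y
  conn_metric : ∀ X Y Z, D X (g Y Z) = g (conn X Y) Z + g Y (conn X Z)
  jacobi : ∀ X Y Z,
    conn X (conn Y Z - conn Z Y) - conn (conn Y Z - conn Z Y) X
      + (conn Y (conn Z X - conn X Z) - conn (conn Z X - conn X Z) Y)
      + (conn Z (conn X Y - conn Y X) - conn (conn X Y - conn Y X) Z) = 0

namespace LeviCivitaCalculus

variable {F V : Type*} [CommRing F] [AddCommGroup V] [Module F V] (L : LeviCivitaCalculus F V)

/-- The Lie bracket. -/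
def bracket (X Y : V) : V := L.conn X Y - L.conn Y X

/-- The curvature `R(X, Y)Z`. -/
def curv (X Y Z : V) : V :=
  L.conn X (L.conn Y Z) - L.conn Y (L.conn X Z) - L.conn (L.bracket X Y) Z

/-- The covariant derivative `(∇_X T)Y` of a field `T` of endomorphisms. -/
def covDeriv (T : V →ₗ[F] V) (X Y : V) : V := L.conn X (T Y) - T (L.conn X Y)

lemma D_mul (X : V) (a b : F) : L.D X (a * b) = a * L.D X b + b * L.D X a := by
  simp [Derivation.leibniz]

lemma eq_of_g_eq {X Y : V} (h : ∀ Z, L.g X Z = L.g Y Z) : X = Y := by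
  apply sub_eq_zero.mp
  apply L.g_definite
  simp [h]

lemma double_eq_zero_vec (L : LeviCivitaCalculus F V) {X : V} (h : (2 : F) • X = 0) : X = 0 := by
  apply L.g_definite
  apply L.double_eq_zero
  simpa using congrArg (fun Z => L.g Z X) h

/-- The bracket acts on functions as the commutator of the two derivatives.  By the Leibniz rule,
this is the Jacobi identity for `X`, `Y` and `a • Z`, with `Z` chosen nonvanishing. -/
lemma D_bracket {Z : V} {η : V →ₗ[F] F} (hZ : η Z = 1) (X Y : V) (a : F) :
    L.D (L.bracket X Y) a = L.D X (L.D Y a) - L.D Y (L.D X a) := by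
  have h1 := L.jacobi X Y (a • Z)
  have h2 := congrArg (fun W => a • W) (L.jacobi X Y Z)
  have h3 : (L.D X (L.D Y a) - L.D Y (L.D X a) - L.D (L.bracket X Y) a) • Z = 0 := by
    simp only [L.conn_smul, map_sub, map_add, map_smul, 
      AddMonoidHom.sub_apply, AddMonoidHom.add_apply, AddMonoidHom.smul_apply, smul_zero,
      Derivation.sub_apply, bracket]
      at h1 h2 ⊢
    linear_combination (norm := module) h1 - h2
  have h4 := congrArg η h3
  simp only [map_smul, hZ, smul_eq_mul, mul_one, map_zero] at h4
  linear_combination -h4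

lemma curv_skew_left (X Y Z : V) : L.curv X Y Z = -L.curv Y X Z := by
  simp only [curv, bracket, map_sub, AddMonoidHom.sub_apply]
  abel

lemma bianchi (X Y Z : V) : L.curv X Y Z + L.curv Y Z X + L.curv Z X Y = 0 := by
  have := L.jacobi X Y Z
  simp only [curv, bracket, map_sub, AddMonoidHom.sub_apply] at this ⊢
  linear_combination (norm := module) this

lemma curv_skew_right {ξ : V} {η : V →ₗ[F] F} (hξ : η ξ = 1) (X Y Z W : V) :
    L.g (L.curv X Y Z) W = -L.g (L.curv X Y W) Z := by
  have h := L.D_bracket hξ X Y (L.g Z W)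
  simp only [L.conn_metric, map_add] at h
  simp only [curv, map_sub, LinearMap.sub_apply]
  rw [L.g_symm (L.conn X (L.conn Y W)) Z, L.g_symm (L.conn Y (L.conn X W)) Z,
    L.g_symm (L.conn _ W) Z]
  linear_combination -h

lemma curv_pair_symm {ξ : V} {η : V →ₗ[F] F} (hξ : η ξ = 1) (X Y Z W : V) :
    L.g (L.curv X Y Z) W = L.g (L.curv Z W X) Y := by
  have b (A B C E : V) := congrArg (fun T => L.g T E) (L.bianchi A B C)
  simp only [map_add, LinearMap.add_apply, map_zero, LinearMap.zero_apply] at b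
  have s (A B C E : V) : L.g (L.curv A B C) E = -L.g (L.curv B A C) E := by
    rw [L.curv_skew_left]; simp
  have r := L.curv_skew_right hξ
  have e₁ := b X Y Z W
  have e₂ : L.g (L.curv Z W X) Y + L.g (L.curv Y Z X) W + L.g (L.curv Y W Z) X = 0 := by
    linear_combination -b Y Z W X + r Y Z W X + r Z W Y X + s W Y Z X
  have e₃ : L.g (L.curv Z W X) Y + L.g (L.curv X W Y) Z + L.g (L.curv Z X Y) W = 0 := by
    linear_combination b Z W X Y - s W X Z Y + r X W Z Y - s X Z W Y + r Z X W Y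
  have e₄ : L.g (L.curv X Y Z) W + L.g (L.curv X W Y) Z + L.g (L.curv Y W Z) X = 0 := by
    linear_combination -b W X Y Z + s W X Y Z + r X Y W Z + r Y W X Z
  apply sub_eq_zero.mp
  apply L.double_eq_zero
  linear_combination e₁ - e₂ - e₃ + e₄

end LeviCivitaCalculus

/-! ### Algebra of almost cosymplectic structures -/

/-- The algebra of an almost `α`-cosymplectic structure `(φ, ξ, η, g)`. -/
structure AlmostCosymplecticCalculus (F V : Type*) [CommRing F] [AddCommGroup V] [Module F V]
    extends LeviCivitaCalculus F V where
  /-- the field of endomorphisms -/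
  φ : V →ₗ[F] V
  /-- the characteristic vector field -/
  ξ : V
  /-- the 1-form -/
  η : V →ₗ[F] F
  /-- the constant `α` -/
  α : F
  D_α : ∀ X, D X α = 0
  φ_sq : ∀ X, φ (φ X) = -X + η X • ξ
  η_ξ : η ξ = 1
  compatible : ∀ X Y, g (φ X) (φ Y) = g X Y - η X * η Y
  dη_eq : ∀ X Y, D X (η Y) - D Y (η X) - η (conn X Y - conn Y X) = 0
  dΦ_eq : ∀ X Y Z,
    D X (g (φ Y) Z) + D Y (g (φ Z) X) + D Z (g (φ X) Y)
      - g (φ (conn X Y - conn Y X)) Z - g (φ (conn Y Z - conn Z Y)) X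
      - g (φ (conn Z X - conn X Z)) Y
      = 2 * α * (η X * g (φ Y) Z + η Y * g (φ Z) X + η Z * g (φ X) Y)

namespace AlmostCosymplecticCalculus

variable {F V : Type*} [CommRing F] [AddCommGroup V] [Module F V]
  (C : AlmostCosymplecticCalculus F V)

lemma φ_ξ : C.φ C.ξ = 0 := by
  have h1 : C.g (C.φ C.ξ) (C.φ C.ξ) = C.g C.ξ C.ξ - 1 := by simp [C.compatible, C.η_ξ]
  have h2 : C.φ (C.φ C.ξ) = 0 := by simp [C.φ_sq, C.η_ξ]
  have h3 := C.φ_sq (C.φ C.ξ)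
  rw [h2, map_zero] at h3
  have h4 := congrArg C.φ h3
  simp only [map_zero, map_add, map_neg, map_smul, h2] at h4
  have h5 : C.η (C.φ C.ξ) * C.η (C.φ C.ξ) = 0 := by
    have := congrArg C.η h4
    simpa using this.symm
  have h6 : C.φ C.ξ = C.η (C.φ C.ξ) • C.ξ := by
    linear_combination (norm := module) h3
  have h7 : C.g (C.φ C.ξ) (C.φ C.ξ) = 0 := by
    nth_rw 1 [h6]
    nth_rw 2 [h6]
    simp only [map_smul, LinearMap.smul_apply, smul_eq_mul]
    linear_combination C.g C.ξ C.ξ * h5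
  exact C.g_definite _ h7

lemma η_φ (X : V) : C.η (C.φ X) = 0 := by
  have h1 := congrArg C.φ (C.φ_sq X)
  have h2 := C.φ_sq (C.φ X)
  have h3 : C.η (C.φ X) • C.ξ = 0 := by
    rw [h1] at h2
    simp only [map_add, map_neg, map_smul, C.φ_ξ, smul_zero, add_zero] at h2
    linear_combination (norm := module) -h2
  simpa [C.η_ξ] using congrArg C.η h3

lemma g_ξ_right (X : V) : C.g X C.ξ = C.η X := by
  have h := C.compatible X C.ξ
  simp only [C.φ_ξ, C.η_ξ, map_zero] at h
  linear_combination -h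

lemma g_ξ_left (X : V) : C.g C.ξ X = C.η X := by rw [C.g_symm, C.g_ξ_right]

lemma g_φ (X Y : V) : C.g (C.φ X) Y = -C.g X (C.φ Y) := by
  have h := C.compatible X (C.φ Y)
  simp only [C.φ_sq, C.η_φ, map_add, map_neg, map_smul, C.g_ξ_right, smul_eq_mul] at h
  linear_combination -h

lemma g_φ_self (X : V) : C.g (C.φ X) X = 0 := by
  apply C.double_eq_zero
  linear_combination C.g_φ X X - C.g_symm X (C.φ X)

/-! #### The covariant derivative of `ξ` -/

/-- The field of endomorphisms `A = ∇ξ`. -/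
def shape : V →ₗ[F] V where
  toFun X := C.conn X C.ξ
  map_add' X Y := by simp
  map_smul' a X := by simp

lemma shape_apply (X : V) : C.shape X = C.conn X C.ξ := rfl

lemma η_shape (X : V) : C.η (C.shape X) = 0 := by
  have h := C.conn_metric X C.ξ C.ξ
  rw [C.g_ξ_left, C.η_ξ, C.g_ξ_left, C.g_ξ_right] at h
  apply C.double_eq_zero
  simp only [Derivation.map_one_eq_zero] at h
  rw [shape_apply]
  linear_combination -h

lemma D_η (X Y : V) : C.D X (C.η Y) = C.η (C.conn X Y) + C.g (C.shape X) Y := by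
  rw [← C.g_ξ_right, C.conn_metric, C.g_ξ_right, C.shape_apply, C.g_symm Y]

lemma shape_symm (X Y : V) : C.g (C.shape X) Y = C.g X (C.shape Y) := by
  have h := C.dη_eq X Y
  simp only [C.D_η, map_sub] at h
  rw [C.g_symm X]
  linear_combination h

lemma shape_ξ : C.shape C.ξ = 0 := by
  apply C.eq_of_g_eq
  intro Z
  rw [C.shape_symm, C.g_ξ_left, C.η_shape]
  simp

lemma conn_ξ_ξ : C.conn C.ξ C.ξ = 0 := C.shape_ξ

lemma η_conn (X : V) {Y : V} (hY : C.η Y = 0) : C.η (C.conn X Y) = -C.g (C.shape X) Y := by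
  have h := C.D_η X Y
  rw [hY, map_zero] at h
  linear_combination -h

lemma η_bracket {X Y : V} (hX : C.η X = 0) (hY : C.η Y = 0) : C.η (C.bracket X Y) = 0 := by
  rw [LeviCivitaCalculus.bracket, map_sub, C.η_conn X hY, C.η_conn Y hX, C.shape_symm, C.g_symm X]
  ring

lemma η_conn_ξ {Y : V} (hY : C.η Y = 0) : C.η (C.conn C.ξ Y) = 0 := by
  rw [C.η_conn _ hY, C.shape_ξ]
  simp

lemma η_bracket_ξ {X : V} (hX : C.η X = 0) : C.η (C.bracket X C.ξ) = 0 := by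
  rw [LeviCivitaCalculus.bracket, map_sub, C.η_conn_ξ hX, ← C.shape_apply, C.η_shape]
  ring

/-! #### The covariant derivative of `φ` -/

lemma covDeriv_φ_skew (X Y Z : V) :
    C.g (C.covDeriv C.φ X Y) Z = -C.g (C.covDeriv C.φ X Z) Y := by
  have h := C.conn_metric X (C.φ Y) Z
  have h' := C.conn_metric X (C.φ Z) Y
  have h'' : C.g (C.φ Y) Z = -C.g (C.φ Z) Y := by rw [C.g_φ, C.g_symm]
  rw [h'', map_neg, h'] at h
  simp only [LeviCivitaCalculus.covDeriv, map_sub, LinearMap.sub_apply]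
  rw [C.g_φ (C.conn X Y), C.g_φ (C.conn X Z), C.g_symm (C.conn X Y), C.g_symm (C.conn X Z)]
  linear_combination -h

lemma covDeriv_φ_φ (X Y : V) :
    C.covDeriv C.φ X (C.φ Y) = -C.φ (C.covDeriv C.φ X Y) + C.g (C.shape X) Y • C.ξ
      + C.η Y • C.shape X := by
  simp only [LeviCivitaCalculus.covDeriv, map_sub, C.φ_sq, map_add, map_neg, C.conn_smul, C.D_η,
    C.shape_apply]
  module

/-- Evaluating `dΦ = 2α η ∧ Φ` on `ξ` bounds together `∇_ξ φ` and `∇ξ`. -/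
lemma covDeriv_φ_ξ_add (Y : V) :
    C.covDeriv C.φ C.ξ Y + C.φ (C.shape Y) + C.shape (C.φ Y) = (2 * C.α) • C.φ Y := by
  apply C.eq_of_g_eq
  intro Z
  have h := C.dΦ_eq C.ξ Y Z
  have hz (W : V) : C.g (C.φ W) C.ξ = 0 := by rw [C.g_ξ_right, C.η_φ]
  simp only [C.φ_ξ, hz, map_zero, LinearMap.zero_apply, C.η_ξ, C.conn_metric, map_sub,
    LinearMap.sub_apply, ← C.shape_apply] at h
  have h1 := C.g_φ (C.shape Z) Y
  have h2 := C.shape_symm Z (C.φ Y)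
  have h3 := C.g_φ (C.conn C.ξ Z) Y
  have h4 := C.g_symm Z (C.shape (C.φ Y))
  have h5 := C.g_symm (C.conn C.ξ Z) (C.φ Y)
  simp only [LeviCivitaCalculus.covDeriv, map_sub, LinearMap.sub_apply, map_add, map_smul,
    LinearMap.add_apply, LinearMap.smul_apply, smul_eq_mul]
  linear_combination h + h1 - h2 - h3 - h4 + h5

/-- In `covDeriv_φ_ξ_add` the first summand anticommutes with `φ`, and the rest commutes with
it. -/
lemma covDeriv_φ_ξ (Y : V) : C.covDeriv C.φ C.ξ Y = 0 := by
  have h1 := congrArg C.φ (C.covDeriv_φ_ξ_add Y)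
  have h2 := C.covDeriv_φ_ξ_add (C.φ Y)
  have h3 := C.covDeriv_φ_φ C.ξ Y
  have hsk := C.covDeriv_φ_skew C.ξ Y C.ξ
  have h0 : C.covDeriv C.φ C.ξ C.ξ = 0 := by
    simp [LeviCivitaCalculus.covDeriv, C.φ_ξ, C.conn_ξ_ξ]
  rw [h0, C.g_ξ_right] at hsk
  simp only [map_zero, LinearMap.zero_apply, neg_zero] at hsk
  simp only [map_add, map_neg, map_smul, C.φ_sq, C.η_shape, C.shape_ξ, smul_zero, zero_smul,
    map_zero, LinearMap.zero_apply, add_zero] at h1 h2 h3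
  have h4 : C.φ (C.covDeriv C.φ C.ξ Y) = 0 := by
    apply C.double_eq_zero_vec
    rw [h3] at h2
    linear_combination (norm := module) h1 - h2
  have h5 := C.φ_sq (C.covDeriv C.φ C.ξ Y)
  rw [h4, hsk, map_zero] at h5
  linear_combination (norm := module) h5

lemma φ_conn_ξ (Y : V) : C.conn C.ξ (C.φ Y) = C.φ (C.conn C.ξ Y) :=
  sub_eq_zero.mp (C.covDeriv_φ_ξ Y)

lemma φ_shape_add (Y : V) : C.φ (C.shape Y) + C.shape (C.φ Y) = (2 * C.α) • C.φ Y := by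
  rw [← C.covDeriv_φ_ξ_add, C.covDeriv_φ_ξ, zero_add]

/-! #### The trace-free part of `∇ξ` -/

/-- The field of endomorphisms `B = ∇ξ - α (I - η ⊗ ξ)`, which turns out to be `-φ h`. -/
def tracefree : V →ₗ[F] V := C.shape - C.α • (LinearMap.id - C.η.smulRight C.ξ)

lemma tracefree_apply (X : V) : C.tracefree X = C.shape X - C.α • (X - C.η X • C.ξ) := by
  simp [tracefree]

lemma shape_eq (X : V) : C.shape X = C.tracefree X + C.α • (X - C.η X • C.ξ) := by
  rw [tracefree_apply]; module

lemma tracefree_symm (X Y : V) : C.g (C.tracefree X) Y = C.g X (C.tracefree Y) := by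
  simp only [tracefree_apply, map_sub, map_smul, LinearMap.sub_apply, LinearMap.smul_apply,
    C.shape_symm, C.g_ξ_left, C.g_ξ_right, smul_eq_mul]
  ring

lemma tracefree_ξ : C.tracefree C.ξ = 0 := by
  simp [tracefree_apply, C.shape_ξ, C.η_ξ]

lemma η_tracefree (X : V) : C.η (C.tracefree X) = 0 := by
  simp [tracefree_apply, C.η_shape, C.η_ξ]

lemma φ_tracefree (X : V) : C.φ (C.tracefree X) = -C.tracefree (C.φ X) := by
  have h := C.φ_shape_add X
  simp only [tracefree_apply, map_sub, map_smul, C.φ_ξ, C.η_φ]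
  linear_combination (norm := module) h

/-- This is the equation `h = φ B`, as `2h` is the Lie derivative of `φ` along `ξ`. -/
lemma bracket_φ (X : V) :
    C.bracket C.ξ (C.φ X) - C.φ (C.bracket C.ξ X) = (2 : F) • C.φ (C.tracefree X) := by
  have h := C.φ_tracefree X
  simp only [LeviCivitaCalculus.bracket, C.φ_conn_ξ, ← C.shape_apply, C.shape_eq, map_add, map_sub,
    map_smul, C.φ_ξ, C.η_φ]
  linear_combination (norm := module) -h

lemma conn_ξ_tracefree_φ (X : V) :
    C.covDeriv C.tracefree C.ξ (C.φ X) = -C.φ (C.covDeriv C.tracefree C.ξ X) := by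
  simp only [LeviCivitaCalculus.covDeriv, C.φ_conn_ξ, map_sub, C.φ_tracefree]
  have h : C.tracefree (C.φ X) = -C.φ (C.tracefree X) := by rw [C.φ_tracefree, neg_neg]
  rw [h, map_neg, C.φ_conn_ξ]
  abel

lemma covDeriv_tracefree_symm (X Y Z : V) :
    C.g (C.covDeriv C.tracefree X Y) Z = C.g (C.covDeriv C.tracefree X Z) Y := by
  have h := C.conn_metric X (C.tracefree Y) Z
  have h' := C.conn_metric X (C.tracefree Z) Y
  have h'' : C.g (C.tracefree Y) Z = C.g (C.tracefree Z) Y := by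
    rw [C.tracefree_symm, C.g_symm]
  rw [h'', h'] at h
  simp only [LeviCivitaCalculus.covDeriv, map_sub, LinearMap.sub_apply]
  rw [C.tracefree_symm (C.conn X Y), C.tracefree_symm (C.conn X Z), C.g_symm (C.conn X Y),
    C.g_symm (C.conn X Z)]
  linear_combination -h

lemma covDeriv_anticomm (X Y : V) :
    C.covDeriv C.φ X (C.tracefree Y) + C.φ (C.covDeriv C.tracefree X Y)
      + C.covDeriv C.tracefree X (C.φ Y) + C.tracefree (C.covDeriv C.φ X Y) = 0 := by
  have h (Z) : C.tracefree (C.φ Z) = -C.φ (C.tracefree Z) := by rw [C.φ_tracefree, neg_neg]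
  simp only [LeviCivitaCalculus.covDeriv, map_sub, h, map_neg]
  abel

end AlmostCosymplecticCalculus

/-! ### Algebraic consequences of the nullity condition -/

namespace AlmostCosymplecticCalculus

variable {F V : Type*} [CommRing F] [AddCommGroup V] [Module F V]
  (C : AlmostCosymplecticCalculus F V)

/-- The `(κ, μ, ν)`-nullity condition, written with `h = φ B` and `φ h = -B`. -/
def Nullity (κ μ ν : F) : Prop :=
  ∀ X Y, C.curv X Y C.ξ =
    C.η Y • (κ • X + μ • C.φ (C.tracefree X) - ν • C.tracefree X)
      - C.η X • (κ • Y + μ • C.φ (C.tracefree Y) - ν • C.tracefree Y)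

variable {C} {κ μ ν : F}

/-- The nullity condition for `R(X, ξ)ξ`, before it is split into the parts commuting and
anticommuting with `φ`. -/
lemma Nullity.jacobi_operator (hR : C.Nullity κ μ ν) (X : V) :
    C.covDeriv C.tracefree C.ξ X + C.tracefree (C.tracefree X) + (2 * C.α) • C.tracefree X
      + (C.α ^ 2 + κ) • (X - C.η X • C.ξ) + μ • C.φ (C.tracefree X) - ν • C.tracefree X = 0 := by
  have h := hR X C.ξ
  simp only [LeviCivitaCalculus.curv, LeviCivitaCalculus.bracket, C.conn_ξ_ξ, map_zero, map_sub,
    AddMonoidHom.sub_apply, C.η_ξ, one_smul, C.tracefree_ξ, smul_zero,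
    ← C.shape_apply] at h
  have hD : C.D C.ξ (C.η X) = C.η (C.conn C.ξ X) := by simp [C.D_η, C.shape_ξ]
  simp only [C.shape_eq, map_add, map_sub, map_smul, C.conn_smul, C.D_α, hD,
    C.η_tracefree, C.tracefree_ξ, C.conn_ξ_ξ, C.η_ξ, smul_eq_mul, mul_one,
    sub_self, smul_zero, zero_smul, add_zero, sub_zero, smul_sub] at h
  simp only [LeviCivitaCalculus.covDeriv]
  linear_combination (norm := module) -h

/-- The part of `R(X, ξ)ξ` that commutes with `φ`. -/
lemma Nullity.commuting_part (hR : C.Nullity κ μ ν) (X : V) :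
    C.tracefree (C.tracefree X) + (C.α ^ 2 + κ) • (X - C.η X • C.ξ) = 0 := by
  set Q : V := C.tracefree (C.tracefree X) + (C.α ^ 2 + κ) • (X - C.η X • C.ξ) with hQ
  have h1 := congrArg C.φ (hR.jacobi_operator X)
  have h2 := hR.jacobi_operator (C.φ X)
  have hB (Z) : C.tracefree (C.φ Z) = -C.φ (C.tracefree Z) := by rw [C.φ_tracefree, neg_neg]
  simp only [map_add, map_sub, map_smul, map_neg, map_zero, hB, C.conn_ξ_tracefree_φ, C.φ_ξ, C.η_φ,
    smul_zero, zero_smul, sub_zero, neg_neg] at h1 h2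
  have hφ : C.φ Q = 0 := by
    apply C.double_eq_zero_vec
    simp only [hQ, map_add, map_sub, map_smul, C.φ_ξ, smul_zero, sub_zero]
    linear_combination (norm := module) h1 + h2
  have hη : C.η Q = 0 := by
    simp [hQ, C.η_tracefree, C.η_ξ]
  have h3 := C.φ_sq Q
  rw [hφ, hη, map_zero] at h3
  linear_combination (norm := module) h3

lemma Nullity.tracefree_sq (hR : C.Nullity κ μ ν) {X : V} (hX : C.η X = 0) :
    C.tracefree (C.tracefree X) = (-(C.α ^ 2 + κ)) • X := by
  have h := hR.commuting_part X
  rw [hX] at h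
  linear_combination (norm := module) h

/-- The part of `R(X, ξ)ξ` that anticommutes with `φ`. -/
lemma Nullity.covDeriv_ξ (hR : C.Nullity κ μ ν) (X : V) :
    C.covDeriv C.tracefree C.ξ X =
      (ν - 2 * C.α) • C.tracefree X - μ • C.φ (C.tracefree X) := by
  have h1 := hR.commuting_part X
  have h2 := hR.jacobi_operator X
  linear_combination (norm := module) h2 - h1

/-- `B` is a Codazzi tensor along the leaves of the distribution `η = 0`. -/
lemma Nullity.codazzi (hR : C.Nullity κ μ ν) {X Y : V} (hX : C.η X = 0) (hY : C.η Y = 0) :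
    C.covDeriv C.tracefree X Y = C.covDeriv C.tracefree Y X := by
  have h := hR X Y
  have hb := C.η_bracket hX hY
  rw [LeviCivitaCalculus.bracket, map_sub] at hb
  simp only [LeviCivitaCalculus.curv, LeviCivitaCalculus.bracket, ← C.shape_apply] at h
  simp only [C.shape_eq, hX, hY, zero_smul, sub_zero, map_add, map_sub, C.conn_smul,
    C.D_α, add_zero] at h
  simp only [LeviCivitaCalculus.covDeriv]
  have hb' := congrArg (fun a => a • C.ξ) hb
  linear_combination (norm := module) h - C.α • hb'

/-- Differentiating `B² = σ I` on the distribution `η = 0`. -/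
lemma Nullity.covDeriv_sq (hR : C.Nullity κ μ ν) (X : V) {Y Z : V} (hY : C.η Y = 0)
    (hZ : C.η Z = 0) :
    C.g (C.covDeriv C.tracefree X (C.tracefree Y)) Z
      + C.g (C.covDeriv C.tracefree X Y) (C.tracefree Z) = C.D X (-(C.α ^ 2 + κ)) * C.g Y Z := by
  have h2 := hR.commuting_part (C.conn X Y)
  have h3 : C.covDeriv C.tracefree X (C.tracefree Y) + C.tracefree (C.covDeriv C.tracefree X Y)
      = C.D X (-(C.α ^ 2 + κ)) • Y + (-(C.α ^ 2 + κ)) • (C.η (C.conn X Y) • C.ξ) := by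
    simp only [LeviCivitaCalculus.covDeriv, hR.tracefree_sq hY, C.conn_smul, map_sub]
    linear_combination (norm := module) -h2
  have h4 := congrArg (fun W => C.g W Z) h3
  simp only [map_add, map_smul, LinearMap.add_apply, LinearMap.smul_apply, C.g_ξ_left, hZ,
    smul_eq_mul, mul_zero, add_zero, C.tracefree_symm] at h4
  exact h4

/-- The trilinear form `g((∇_X B)Y, Z)` is totally symmetric and skew under `B`, up to the
derivatives of `σ`.  Solving for it as in Koszul's formula and using its symmetry again leaves
an identity in which only `B` and `dσ` occur. -/
lemma Nullity.D_sigma_identity (hR : C.Nullity κ μ ν) {X Y Z : V} (hX : C.η X = 0)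
    (hY : C.η Y = 0) (hZ : C.η Z = 0) :
    C.D Y κ * C.g (C.tracefree X) Z - C.D X κ * C.g (C.tracefree Y) Z
      - C.D (C.tracefree X) κ * C.g Y Z + C.D (C.tracefree Y) κ * C.g X Z = 0 := by
  have hα (W) : C.D W (-(C.α ^ 2 + κ)) = -C.D W κ := by
    simp [pow_two, C.D_mul, C.D_α]
  -- the symmetric trilinear form with `B` applied to its first argument
  have koszul {X Y Z : V} (hX : C.η X = 0) (hY : C.η Y = 0) (hZ : C.η Z = 0) :
      2 * C.g (C.covDeriv C.tracefree (C.tracefree X) Y) Z =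
        -C.D Y κ * C.g X Z - C.D Z κ * C.g X Y + C.D X κ * C.g Y Z := by
    have e1 := hR.covDeriv_sq X hY hZ
    have e2 := hR.covDeriv_sq Y hX hZ
    have e3 := hR.covDeriv_sq Z hX hY
    rw [hα] at e1 e2 e3
    have c {X Y : V} (hX : C.η X = 0) (hY : C.η Y = 0) (Z : V) :
        C.g (C.covDeriv C.tracefree X Y) Z = C.g (C.covDeriv C.tracefree Y X) Z := by
      rw [hR.codazzi hX hY]
    have t := C.covDeriv_tracefree_symm
    linear_combination e2 + e3 - e1 + c (C.η_tracefree X) hY Z + t (C.tracefree X) Y Z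
      + c (C.η_tracefree X) hZ Y - c hY hX (C.tracefree Z) - c hZ hX (C.tracefree Y)
      - t X Z (C.tracefree Y)
  have hBX := C.η_tracefree X
  have hBY := C.η_tracefree Y
  have k1 := koszul hBX hY hZ
  have k2 := koszul hBY hX hZ
  rw [hR.tracefree_sq hX] at k1
  rw [hR.tracefree_sq hY] at k2
  have a := congrArg (fun W => C.g W Z) (hR.codazzi hX hY)
  have b : C.g (C.tracefree Y) X = C.g (C.tracefree X) Y := by rw [C.tracefree_symm, C.g_symm]
  simp only [LeviCivitaCalculus.covDeriv, map_smul, map_sub, LinearMap.smul_apply,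
    LinearMap.sub_apply, AddMonoidHom.smul_apply, smul_eq_mul] at k1 k2 a
  rw [b] at k2
  linear_combination k1 - k2 - 2 * (-(C.α ^ 2 + κ)) * a

lemma Nullity.g_tracefree_self (hR : C.Nullity κ μ ν) {Y : V} (hY : C.η Y = 0) :
    C.g (C.tracefree Y) (C.tracefree Y) = -(C.α ^ 2 + κ) * C.g Y Y := by
  rw [C.tracefree_symm, hR.tracefree_sq hY, map_smul, smul_eq_mul]

/-- The derivative of `g(BY, BY) = σ g(Y, Y)`.  At a point where `σ` vanishes so does `B Y`, and
then the right side is zero there. -/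
lemma Nullity.D_mul_g_self_of_tracefree (hR : C.Nullity κ μ ν) (X : V) {Y : V} (hY : C.η Y = 0) :
    -C.D X κ * C.g Y Y = 2 * C.g (C.conn X (C.tracefree Y)) (C.tracefree Y)
      + 2 * (C.α ^ 2 + κ) * C.g (C.conn X Y) Y := by
  have h := congrArg (C.D X) (hR.g_tracefree_self hY)
  simp only [C.conn_metric, C.D_mul, pow_two, C.D_α, map_neg, map_add, mul_zero, add_zero,
    zero_add] at h
  linear_combination -h + C.g_symm (C.tracefree Y) (C.conn X (C.tracefree Y))
    + (C.α ^ 2 + κ) * C.g_symm Y (C.conn X Y)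

lemma Nullity.D_ξ_mul_g_self (hR : C.Nullity κ μ ν) {Y : V} (hY : C.η Y = 0) :
    C.D C.ξ κ * C.g Y Y = 2 * (ν - 2 * C.α) * (C.α ^ 2 + κ) * C.g Y Y := by
  have h := hR.covDeriv_sq C.ξ hY hY
  have hα : C.D C.ξ (-(C.α ^ 2 + κ)) = -C.D C.ξ κ := by simp [pow_two, C.D_mul, C.D_α]
  rw [hα, hR.covDeriv_ξ, hR.covDeriv_ξ, hR.tracefree_sq hY] at h
  simp only [map_sub, map_smul, LinearMap.sub_apply, LinearMap.smul_apply, C.g_φ_self, smul_eq_mul,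
    hR.g_tracefree_self hY] at h
  linear_combination h

/-- If `σ` is invertible and its derivative vanishes along the distribution `η = 0`, then `B` is
parallel along that distribution. -/
lemma Nullity.tracefree_parallel (hR : C.Nullity κ μ ν)
    (hσ : ∀ a, (C.α ^ 2 + κ) * a = 0 → a = 0) (hκ : ∀ X, C.η X = 0 → C.D X κ = 0)
    {X Y Z : V} (hX : C.η X = 0) (hY : C.η Y = 0) (hZ : C.η Z = 0) :
    C.g (C.covDeriv C.tracefree X Y) Z = 0 := by
  have c {X Y : V} (hX : C.η X = 0) (hY : C.η Y = 0) (Z : V) :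
      C.g (C.covDeriv C.tracefree X Y) Z = C.g (C.covDeriv C.tracefree Y X) Z := by
    rw [hR.codazzi hX hY]
  have t := C.covDeriv_tracefree_symm
  have hα (W) (hW : C.η W = 0) : C.D W (-(C.α ^ 2 + κ)) = 0 := by
    simp [pow_two, C.D_mul, C.D_α, hκ W hW]
  have e {X Y Z : V} (hX : C.η X = 0) (hY : C.η Y = 0) (hZ : C.η Z = 0) :
      C.g (C.covDeriv C.tracefree X (C.tracefree Y)) Z
        + C.g (C.covDeriv C.tracefree X Y) (C.tracefree Z) = 0 := by
    rw [hR.covDeriv_sq X hY hZ, hα X hX, zero_mul]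
  -- a trilinear form that is symmetric and skew under `B` vanishes on the image of `B`
  have k {X Y Z : V} (hX : C.η X = 0) (hY : C.η Y = 0) (hZ : C.η Z = 0) :
      C.g (C.covDeriv C.tracefree X Y) (C.tracefree Z) = 0 := by
    apply C.double_eq_zero
    linear_combination e hX hY hZ + e hY hX hZ - e hZ hX hY
      - c hX (C.η_tracefree Y) Z - t (C.tracefree Y) X Z - c (C.η_tracefree Y) hZ X
      - t Z (C.tracefree Y) X - c hY (C.η_tracefree X) Z - t (C.tracefree X) Y Z
      - c (C.η_tracefree X) hZ Y - c hY hX (C.tracefree Z)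
  have h := k hX hY (C.η_tracefree Z)
  rw [hR.tracefree_sq hZ] at h
  apply hσ
  simp only [map_smul, smul_eq_mul] at h
  linear_combination -h

/-- A trilinear form with the symmetries of `g((∇_X φ)Y, Z)` for an almost Kähler structure `φ`
commuting up to sign with a parallel involution `B` must vanish. -/
lemma trilinear_eq_zero {W : Type*} (T : W → W → W → F) (φ B : W → W) {σ : F}
    (two : ∀ a : F, 2 * a = 0 → a = 0) (hσ : ∀ a, σ * a = 0 → a = 0)
    (skew : ∀ X Y Z, T X Y Z = -T X Z Y) (cyc : ∀ X Y Z, T X Y Z + T Y Z X + T Z X Y = 0)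
    (hB : ∀ X Y Z, T X (B Y) Z = -T X Y (B Z)) (hφ : ∀ X Y Z, T X (φ Y) Z = T X Y (φ Z))
    (anti : ∀ X Y Z, T X (φ (B Y)) Z = -T X (B (φ Y)) Z)
    (sq : ∀ X Y Z, T X (B (B Y)) Z = σ * T X Y Z)
    (neg : ∀ X Y Z, T X Y (φ (φ Z)) = -T X Y Z)
    (X Y Z : W) : T X Y Z = 0 := by
  -- `S X Y Z` is `2σ` times the part of `T` in which `X` and `Y` lie in the same eigenspace
  let S X Y Z := σ * T X Y Z + T (B X) (B Y) Z
  have S_symm X Y Z : S X Y Z = S Y X Z := by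
    simp only [S]
    linear_combination cyc (B X) (B Y) Z - skew (B Y) Z (B X) - hB Z (B X) Y + sq Z X Y +
      σ * cyc X Y Z - σ * skew Y Z X
  have S_skew X Y Z : S X Y (φ Z) = -S X Z (φ Y) := by
    simp only [S]
    linear_combination σ * skew X Y (φ Z) - σ * hφ X Z Y - hφ (B X) (B Y) Z + anti (B X) Y Z
      - hB (B X) (φ Y) Z + skew (B X) (φ Y) (B Z)
  -- a trilinear form symmetric in one pair of arguments and skew in another pair vanishes
  have S_φ X Y Z : S X Y (φ Z) = 0 := by
    apply two
    linear_combination S_skew X Y Z - S_symm X Z (φ Y) - S_skew Z X Y + S_symm Z Y (φ X)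
      + S_skew Y Z X - S_symm Y X (φ Z)
  have S_zero X Y Z : S X Y Z = 0 := by
    have h := S_φ X Y (φ Z)
    simp only [S, neg] at h ⊢
    linear_combination -h
  apply hσ
  apply two
  linear_combination S_zero X Y Z - S_zero X Z Y + σ * skew X Y Z + hB (B X) Z Y
    - skew (B X) Z (B Y)

/-- Under the same conditions `φ` is parallel along the distribution `η = 0`, whose leaves are
therefore Kähler. -/
lemma Nullity.φ_parallel (hR : C.Nullity κ μ ν)
    (hσ : ∀ a, (C.α ^ 2 + κ) * a = 0 → a = 0) (hκ : ∀ X, C.η X = 0 → C.D X κ = 0)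
    {X Y Z : V} (hX : C.η X = 0) (hY : C.η Y = 0) (hZ : C.η Z = 0) :
    C.g (C.covDeriv C.φ X Y) Z = 0 := by
  let W := LinearMap.ker C.η
  have hW (X : W) : C.η X = 0 := X.2
  refine trilinear_eq_zero (W := W) (fun X Y Z => C.g (C.covDeriv C.φ X Y) Z)
    (fun X => ⟨C.φ X, C.η_φ X⟩) (fun X => ⟨C.tracefree X, C.η_tracefree X⟩) (σ := -(C.α ^ 2 + κ))
    C.double_eq_zero ?_ ?_ ?_ ?_ ?_ ?_ ?_ ?_ ⟨X, hX⟩ ⟨Y, hY⟩ ⟨Z, hZ⟩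
  · intro a ha
    exact hσ a (by linear_combination -ha)
  · exact fun X Y Z => C.covDeriv_φ_skew X Y Z
  · intro X Y Z
    have h := C.dΦ_eq X Y Z
    rw [hW X, hW Y, hW Z] at h
    simp only [C.conn_metric, map_sub, LinearMap.sub_apply, zero_mul, add_zero, mul_zero] at h
    simp only [LeviCivitaCalculus.covDeriv, map_sub, LinearMap.sub_apply]
    have s (A B : V) : C.g (C.φ A) B = -C.g (C.φ B) A := by rw [C.g_φ, C.g_symm]
    linear_combination h - s Z (C.conn Y X) - s X (C.conn Z Y) - s Y (C.conn X Z)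
  · intro X Y Z
    have h := congrArg (fun A => C.g A Z) (C.covDeriv_anticomm X Y)
    have h1 := hR.tracefree_parallel hσ hκ (hW X) (hW Y) (C.η_φ Z)
    have h2 := hR.tracefree_parallel hσ hκ (hW X) (C.η_φ Y) (hW Z)
    simp only [map_add, LinearMap.add_apply, map_zero, LinearMap.zero_apply, C.g_φ,
      C.tracefree_symm, h1, h2] at h
    linear_combination h
  · intro X Y Z
    simp only [C.covDeriv_φ_φ, map_add, map_neg, map_smul, LinearMap.add_apply, LinearMap.neg_apply,
      LinearMap.smul_apply, C.g_φ, C.g_ξ_left, hW, smul_eq_mul]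
    ring
  · intro X Y Z
    simp only [C.φ_tracefree, LeviCivitaCalculus.covDeriv, map_neg, map_sub, LinearMap.neg_apply,
      LinearMap.sub_apply]
    ring
  · intro X Y Z
    simp only [hR.tracefree_sq (hW Y), LeviCivitaCalculus.covDeriv, map_smul, map_sub,
      LinearMap.smul_apply, LinearMap.sub_apply, C.conn_smul, map_add, LinearMap.add_apply,
      smul_eq_mul]
    ring
  · intro X Y Z
    simp [C.φ_sq, hW]

/-- By the pair symmetry of the curvature this is the nullity condition on `R(Y, Z)ξ`, whose right
side vanishes for `Y`, `Z` in the distribution `η = 0`. -/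
lemma Nullity.curv_ξ (hR : C.Nullity κ μ ν) (X : V) {Y Z : V} (hY : C.η Y = 0) (hZ : C.η Z = 0) :
    C.g (C.curv X C.ξ Y) Z = 0 := by
  rw [C.curv_pair_symm C.η_ξ, C.curv_skew_right C.η_ξ, hR, hY, hZ]
  simp

/-- The Ricci identity for `B` in the directions `X` and `ξ`, when `B` and `φ` are parallel along
the leaves. -/
lemma Nullity.ricci_identity (hR : C.Nullity κ μ ν)
    (hσ : ∀ a, (C.α ^ 2 + κ) * a = 0 → a = 0) (hκ : ∀ X, C.η X = 0 → C.D X κ = 0)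
    {X Y Z : V} (hX : C.η X = 0) (hY : C.η Y = 0) (hZ : C.η Z = 0) :
    C.D X ν * C.g (C.tracefree Y) Z - C.D X μ * C.g (C.φ (C.tracefree Y)) Z = 0 := by
  have p {X Y Z : V} (hX : C.η X = 0) (hY : C.η Y = 0) (hZ : C.η Z = 0) :=
    hR.tracefree_parallel hσ hκ hX hY hZ
  have h1 := hR.curv_ξ X (C.η_tracefree Y) hZ
  have h2 := hR.curv_ξ X hY (C.η_tracefree Z)
  rw [← C.tracefree_symm] at h2
  have p1 := p hX (C.η_conn_ξ hY) hZ
  have p2 := p (C.η_bracket_ξ hX) hY hZ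
  have p3 := p hX hY hZ
  have p4 := p hX hY (C.η_φ Z)
  have p5 := p hX hY (C.η_conn_ξ hZ)
  have p6 := hR.φ_parallel hσ hκ hX (C.η_tracefree Y) hZ
  have m := C.conn_metric C.ξ (C.covDeriv C.tracefree X Y) Z
  rw [p3, p5, map_zero, add_zero] at m
  rw [← neg_eq_zero, ← C.g_φ] at p4
  have d1 := hR.covDeriv_ξ Y
  have d2 := congrArg (fun W => C.g W Z) (hR.covDeriv_ξ (C.conn X Y))
  have d3 := congrArg (fun W => C.g (C.conn X W) Z) d1
  have hα : C.D X (2 * C.α) = 0 := by simp [two_mul, C.D_α]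
  simp only [LeviCivitaCalculus.covDeriv, LeviCivitaCalculus.curv, map_sub, map_add, map_smul,
    C.conn_smul, LinearMap.sub_apply, LinearMap.add_apply, LinearMap.smul_apply, smul_eq_mul, hα,
    sub_zero]
    at h1 h2 p1 p2 p3 p4 p5 p6 m d1 d2 d3
  linear_combination -d3 + h1 - h2 - p1 - m + d2 + p2 - (ν - 2 * C.α) * p3 + μ * (p4 + p6)

/-- The Ricci identity for `B`, paired with `B Y` and with `φ B Y`. -/
lemma Nullity.D_mul_g_self (hR : C.Nullity κ μ ν)
    (hσ : ∀ a, (C.α ^ 2 + κ) * a = 0 → a = 0) (hκ : ∀ X, C.η X = 0 → C.D X κ = 0)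
    {X Y : V} (hX : C.η X = 0) (hY : C.η Y = 0) :
    C.D X μ * C.g Y Y = 0 ∧ C.D X ν * C.g Y Y = 0 := by
  have hB := hR.g_tracefree_self hY
  have h1 := hR.ricci_identity hσ hκ hX hY (C.η_tracefree Y)
  have h2 := hR.ricci_identity hσ hκ hX hY (C.η_φ (C.tracefree Y))
  rw [C.g_φ_self, hB] at h1
  rw [C.compatible, C.η_tracefree, C.g_symm, C.g_φ_self, hB] at h2
  constructor
  · apply hσ
    linear_combination h2
  · apply hσ
    linear_combination -h1

end AlmostCosymplecticCalculus

/-! ### Smooth vector fields and the smoothness of the Levi-Civita connection -/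

section Smooth

variable {E : Type*} [NormedAddCommGroup E] [NormedSpace ℝ E]
  {M : Type*} [TopologicalSpace M] [ChartedSpace E M] [IsManifold 𝓘(ℝ, E) ∞ M]

lemma IsSmoothVF.mdifferentiableAt {X : Π x : M, TangentSpace 𝓘(ℝ, E) x} (hX : IsSmoothVF X)
    (x : M) : MDiffAt (T% X) x :=
  ContMDiff.mdifferentiableAt (n := ∞) hX (by simp)

lemma IsSmoothVF.dirDeriv {X : Π x : M, TangentSpace 𝓘(ℝ, E) x} (hX : IsSmoothVF X)
    {f : M → ℝ} (hf : ContMDiff 𝓘(ℝ, E) 𝓘(ℝ, ℝ) ∞ f) :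
    ContMDiff 𝓘(ℝ, E) 𝓘(ℝ, ℝ) ∞ (dirDeriv X f) := by
  have h1 : ContMDiff 𝓘(ℝ, E) 𝓘(ℝ, ℝ).tangent ∞
      (fun x => tangentMap 𝓘(ℝ, E) 𝓘(ℝ, ℝ) f (TotalSpace.mk' E x (X x))) :=
    (hf.contMDiff_tangentMap (m := ∞) (by simp)).comp hX
  exact (contMDiff_snd_tangentBundle_modelSpace ℝ 𝓘(ℝ, ℝ)).comp h1

lemma IsSmoothVF.metric {X Y : Π x : M, TangentSpace 𝓘(ℝ, E) x} (hX : IsSmoothVF X)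
    (hY : IsSmoothVF Y)
    (g : ContMDiffRiemannianMetric 𝓘(ℝ, E) ∞ E (fun x : M => TangentSpace 𝓘(ℝ, E) x)) :
    ContMDiff 𝓘(ℝ, E) 𝓘(ℝ, ℝ) ∞ (metric g X Y) := by
  have : ContMDiff 𝓘(ℝ, E) (𝓘(ℝ, E).prod 𝓘(ℝ)) ∞
      (fun m ↦ TotalSpace.mk' ℝ (E := Bundle.Trivial M ℝ) m (g.inner m (X m) (Y m))) := by
    apply ContMDiff.clm_bundle_apply₂ (F₁ := E) (F₂ := E)
    · exact g.contMDiff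
    · exact hX
    · exact hY
  intro x
  exact (contMDiffAt_totalSpace.mp (this x)).2

lemma IsSmoothVF.mlieBracket [CompleteSpace E] {X Y : Π x : M, TangentSpace 𝓘(ℝ, E) x}
    (hX : IsSmoothVF X) (hY : IsSmoothVF Y) : IsSmoothVF (mlieBracket 𝓘(ℝ, E) X Y) := fun x =>
  have : IsManifold 𝓘(ℝ, E) (∞ + 1) M := by simpa
  have : IsManifold 𝓘(ℝ, E) (minSmoothness ℝ 2) M :=
    .of_le (n := ∞) (by simpa using ENat.LEInfty.out)
  ContMDiffAt.mlieBracket_vectorField (m := ⊤) (n := ⊤) (hX x) (hY x) (by simp)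

lemma IsSmoothVF.koszul [CompleteSpace E] {X Y Z : Π x : M, TangentSpace 𝓘(ℝ, E) x}
    (hX : IsSmoothVF X) (hY : IsSmoothVF Y) (hZ : IsSmoothVF Z)
    (g : ContMDiffRiemannianMetric 𝓘(ℝ, E) ∞ E (fun x : M => TangentSpace 𝓘(ℝ, E) x)) :
    ContMDiff 𝓘(ℝ, E) 𝓘(ℝ, ℝ) ∞ (koszul g X Y Z) :=
  (((((hX.dirDeriv (hY.metric hZ g)).add (hY.dirDeriv (hZ.metric hX g))).sub
    (hZ.dirDeriv (hX.metric hY g))).add ((hX.mlieBracket hY).metric hZ g)).sub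
    ((hY.mlieBracket hZ).metric hX g)).add ((hZ.mlieBracket hX).metric hY g)

/-- A vector field that is smooth near a point agrees near that point with a globally smooth one. -/
lemma exists_isSmoothVF_eventuallyEq [FiniteDimensional ℝ E] [T2Space M]
    {X : Π x : M, TangentSpace 𝓘(ℝ, E) x} {u : Set M} {p : M} (hu : IsOpen u) (hp : p ∈ u)
    (hX : ContMDiffOn 𝓘(ℝ, E) (𝓘(ℝ, E).prod 𝓘(ℝ, E)) ∞ (T% X) u) :
    ∃ Y : Π x : M, TangentSpace 𝓘(ℝ, E) x, IsSmoothVF Y ∧ ∀ᶠ x in nhds p, Y x = X x := by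
  obtain ⟨ψ, -, hψ⟩ :=
    (SmoothBumpFunction.nhds_basis_tsupport (I := 𝓘(ℝ, E)) p).mem_iff.mp (hu.mem_nhds hp)
  refine ⟨(ψ : M → ℝ) • X, ?_, ?_⟩
  · exact ContMDiffOn.smul_section_of_tsupport ψ.contMDiff.contMDiffOn hu hψ hX
  · filter_upwards [ψ.eventuallyEq_one] with x hx
    simp [hx]

/-- Around every point there is a local frame of the tangent bundle consisting of globally defined
smooth vector fields. -/
lemma exists_isSmoothVF_isLocalFrameOn [FiniteDimensional ℝ E] [T2Space M] (p : M) :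
    ∃ (s : Fin (Module.finrank ℝ E) → Π x : M, TangentSpace 𝓘(ℝ, E) x) (u : Set M),
      (∀ i, IsSmoothVF (s i)) ∧ IsOpen u ∧ p ∈ u ∧ IsLocalFrameOn 𝓘(ℝ, E) E ∞ s u := by
  let e := trivializationAt E (TangentSpace 𝓘(ℝ, E)) p
  let b := Module.finBasis ℝ E
  have hp : p ∈ e.baseSet := FiberBundle.mem_baseSet_trivializationAt' p
  have h (i) := exists_isSmoothVF_eventuallyEq e.open_baseSet hp
    (e.contMDiffOn_localFrame_baseSet (I := 𝓘(ℝ, E)) ∞ b i)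
  choose s hs hse using h
  have hall := (Filter.eventually_all.mpr hse).and (e.open_baseSet.mem_nhds hp)
  obtain ⟨u, hu, huo, hpu⟩ := eventually_nhds_iff.mp hall
  refine ⟨s, u, hs, huo, hpu, ?_⟩
  exact ((e.isLocalFrameOn_localFrame_baseSet 𝓘(ℝ, E) ∞ b).mono fun x hx => (hu x hx).2).congr
    fun i x hx => ((hu x hx).1 i).symm

lemma exists_isSmoothVF_apply_eq [FiniteDimensional ℝ E] [T2Space M] {p : M}
    (v : TangentSpace 𝓘(ℝ, E) p) :
    ∃ Y : Π x : M, TangentSpace 𝓘(ℝ, E) x, IsSmoothVF Y ∧ Y p = v := by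
  obtain ⟨s, u, hs, -, hp, hf⟩ := exists_isSmoothVF_isLocalFrameOn (E := E) p
  let c := (hf.toBasisAt hp).repr v
  refine ⟨fun x => ∑ i, c i • s i x,
    ContMDiff.sum_section fun i _ => (hs i).const_smul_section, ?_⟩
  have := (hf.toBasisAt hp).sum_repr v
  simpa using this

omit [IsManifold 𝓘(ℝ, E) ∞ M] in
lemma contMDiffAt_det {ι : Type*} [Fintype ι] [DecidableEq ι] {G : M → Matrix ι ι ℝ} {p : M}
    (hG : ∀ i j, ContMDiffAt 𝓘(ℝ, E) 𝓘(ℝ, ℝ) ∞ (fun x => G x i j) p) :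
    ContMDiffAt 𝓘(ℝ, E) 𝓘(ℝ, ℝ) ∞ (fun x => (G x).det) p := by
  simp only [Matrix.det_apply']
  exact contMDiffAt_finsetSum fun σ _ => contMDiffAt_const.mul
    (contMDiffAt_finsetProd fun i _ => hG _ _)

omit [IsManifold 𝓘(ℝ, E) ∞ M] in
lemma contMDiffAt_adjugate {ι : Type*} [Fintype ι] [DecidableEq ι] {G : M → Matrix ι ι ℝ} {p : M}
    (hG : ∀ i j, ContMDiffAt 𝓘(ℝ, E) 𝓘(ℝ, ℝ) ∞ (fun x => G x i j) p) (i j : ι) :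
    ContMDiffAt 𝓘(ℝ, E) 𝓘(ℝ, ℝ) ∞ (fun x => (G x).adjugate i j) p := by
  simp only [Matrix.adjugate_apply]
  refine contMDiffAt_det fun k l => ?_
  by_cases hk : k = j
  · subst hk
    simpa using contMDiffAt_const
  · simpa [Matrix.updateRow_ne hk] using hG k l

/-- Smoothness of a vector field can be tested by its inner products with smooth vector fields:
in a local frame, the coefficients are recovered from them by Cramer's rule for the Gram matrix. -/
lemma isSmoothVF_of_metric [FiniteDimensional ℝ E] [T2Space M]
    (g : ContMDiffRiemannianMetric 𝓘(ℝ, E) ∞ E (fun x : M => TangentSpace 𝓘(ℝ, E) x))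
    {X : Π x : M, TangentSpace 𝓘(ℝ, E) x}
    (h : ∀ Z, IsSmoothVF Z → ContMDiff 𝓘(ℝ, E) 𝓘(ℝ, ℝ) ∞ (AlmostCosymplectic.metric g X Z)) :
    IsSmoothVF X := by
  intro p
  obtain ⟨s, u, hs, huo, hp, hf⟩ := exists_isSmoothVF_isLocalFrameOn (E := E) p
  refine hf.contMDiffAt_of_coeff (fun i => ?_) (huo.mem_nhds hp)
  let G (x : M) : Matrix _ _ ℝ := Matrix.of fun i j => AlmostCosymplectic.metric g (s i) (s j) x
  let k (x : M) (j) : ℝ := AlmostCosymplectic.metric g X (s j) x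
  have hG : ∀ i j, ContMDiffAt 𝓘(ℝ, E) 𝓘(ℝ, ℝ) ∞ (fun x => G x i j) p :=
    fun i j => ((hs i).metric (hs j) g) p
  have hdet (x) (hx : x ∈ u) : (G x).det ≠ 0 := by
    intro h0
    obtain ⟨v, hv, hv0⟩ := Matrix.exists_mulVec_eq_zero_iff.mpr h0
    have hw : ∑ i, v i • s i x = 0 := by
      by_contra hne
      have hpos := g.pos x _ hne
      have hzero : g.inner x (∑ i, v i • s i x) (∑ i, v i • s i x) = v ⬝ᵥ (G x).mulVec v := by
        simp only [map_sum, map_smul, sum_apply, smul_apply, smul_eq_mul, dotProduct,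
          Matrix.mulVec, G, AlmostCosymplectic.metric, Finset.mul_sum, Matrix.of_apply]
        exact Finset.sum_congr rfl fun i _ => Finset.sum_congr rfl fun j _ => by
          rw [g.symm]; ring
      rw [hzero, hv0] at hpos
      simp at hpos
    exact hv (funext (Fintype.linearIndependent_iff.mp (hf.linearIndependent hx) v hw))
  have key (x) (hx : x ∈ u) : hf.coeff i x (X x) =
      (G x).det⁻¹ * ∑ j, k x j * (G x).adjugate j i := by
    have h1 : Matrix.vecMul (fun i => hf.coeff i x (X x)) (G x) = k x := by
      ext j
      simp only [k, AlmostCosymplectic.metric]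
      nth_rw 2 [hf.coeff_sum_eq X hx]
      simp [Matrix.vecMul, dotProduct, G, AlmostCosymplectic.metric, map_sum]
    have h2 := congrArg (fun w => Matrix.vecMul w (G x).adjugate i) h1
    simp only [Matrix.vecMul_vecMul, Matrix.mul_adjugate, Matrix.vecMul_smul, Matrix.vecMul_one,
      Pi.smul_apply, smul_eq_mul] at h2
    rw [eq_inv_mul_iff_mul_eq₀ (hdet x hx), h2]
    rfl
  have hsm : ContMDiffAt 𝓘(ℝ, E) 𝓘(ℝ, ℝ) ∞
      (fun x => (G x).det⁻¹ * ∑ j, k x j * (G x).adjugate j i) p :=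
    ((contMDiffAt_det hG).inv₀ (hdet p hp)).mul
      (contMDiffAt_finsetSum fun j _ => (h (s j) (hs j) p).mul (contMDiffAt_adjugate hG j i))
  exact hsm.congr_of_eventuallyEq (Filter.eventually_of_mem (huo.mem_nhds hp) key)

/-- The Levi-Civita connection preserves smoothness. -/
lemma IsSmoothVF.nabla [FiniteDimensional ℝ E] [CompleteSpace E] [T2Space M]
    {X Y : Π x : M, TangentSpace 𝓘(ℝ, E) x} (hX : IsSmoothVF X) (hY : IsSmoothVF Y)
    (g : ContMDiffRiemannianMetric 𝓘(ℝ, E) ∞ E (fun x : M => TangentSpace 𝓘(ℝ, E) x)) :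
    IsSmoothVF (nabla g X Y) := by
  refine isSmoothVF_of_metric g fun Z hZ => ?_
  have h : AlmostCosymplectic.metric g (AlmostCosymplectic.nabla g X Y) Z =
      fun x => 2⁻¹ * AlmostCosymplectic.koszul g X Y Z x := by
    ext x
    have := leviCivitaFun_spec (g := g) (hX.mdifferentiableAt x) (hY.mdifferentiableAt x)
      (hZ.mdifferentiableAt x)
    rw [← this]
    simp only [inv_mul_cancel_left₀ (two_ne_zero (α := ℝ))]
    rfl
  rw [h]
  exact contMDiff_const.mul (hX.koszul hY hZ g)

end Smooth

/-! ### The calculus of an almost cosymplectic manifold -/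

section Calculus

variable {E : Type*} [NormedAddCommGroup E] [NormedSpace ℝ E]
  {M : Type*} [TopologicalSpace M] [ChartedSpace E M] [IsManifold 𝓘(ℝ, E) ∞ M]

variable (E M) in
/-- The ring of smooth functions. -/
abbrev SmoothFun := C^∞⟮𝓘(ℝ, E), M; 𝓘(ℝ, ℝ), ℝ⟯

variable (E M) in
/-- The smooth vector fields. -/
abbrev SmoothVF := Cₛ^∞⟮𝓘(ℝ, E); E, fun x : M => TangentSpace 𝓘(ℝ, E) x⟯

instance : SMul (SmoothFun E M) (SmoothVF E M) :=
  ⟨fun f X => ⟨fun x => f x • X x, f.contMDiff.smul_section X.contMDiff⟩⟩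

/-- Smooth vector fields form a module over the smooth functions. -/
instance : Module (SmoothFun E M) (SmoothVF E M) where
  one_smul X := by ext x; exact one_smul ℝ (X x)
  mul_smul f f' X := by ext x; exact mul_smul (f x) (f' x) (X x)
  smul_zero f := by ext x; exact smul_zero (f x)
  smul_add f X Y := by ext x; exact smul_add (f x) (X x) (Y x)
  add_smul f f' X := by ext x; exact add_smul (f x) (f' x) (X x)
  zero_smul X := by ext x; exact zero_smul ℝ (X x)

omit [IsManifold 𝓘(ℝ, E) ∞ M] in
lemma SmoothFun.two_apply (x : M) : (2 : SmoothFun E M) x = 2 := by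
  rw [← one_add_one_eq_two, ← one_add_one_eq_two]
  rfl

lemma SmoothVF.isSmoothVF (X : SmoothVF E M) : IsSmoothVF (X : Π x : M, TangentSpace 𝓘(ℝ, E) x) :=
  X.contMDiff

omit [IsManifold 𝓘(ℝ, E) ∞ M] in
lemma SmoothFun.mdifferentiableAt (f : SmoothFun E M) (x : M) :
    MDifferentiableAt 𝓘(ℝ, E) 𝓘(ℝ, ℝ) f x :=
  f.contMDiff.mdifferentiableAt (by simp)

lemma SmoothVF.mdifferentiableAt (X : SmoothVF E M) (x : M) : MDiffAt (T% fun y => X y) x :=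
  X.isSmoothVF.mdifferentiableAt x

/-- The derivation of the ring of smooth functions given by a smooth vector field. -/
def smoothDeriv : SmoothVF E M →ₗ[SmoothFun E M] Derivation ℤ (SmoothFun E M) (SmoothFun E M) where
  toFun X := Derivation.mk'
    (AddMonoidHom.toIntLinearMap
      { toFun := fun f => ⟨dirDeriv X f, X.isSmoothVF.dirDeriv f.contMDiff⟩
        map_zero' := by
          ext x
          change mvfderiv 𝓘(ℝ, E) (fun _ => (0 : ℝ)) x (X x) = 0
          rw [mvfderiv_const]
          rfl
        map_add' := fun f f' => by
          ext x
          change mvfderiv 𝓘(ℝ, E) (⇑f + ⇑f') x (X x) = _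
          rw [mvfderiv_add (f.mdifferentiableAt x) (f'.mdifferentiableAt x)]
          rfl })
    (fun f f' => by
      ext x
      change mvfderiv 𝓘(ℝ, E) (⇑f * ⇑f') x (X x) = _
      rw [mvfderiv_mul (f.mdifferentiableAt x) (f'.mdifferentiableAt x)]
      rfl)
  map_add' X Y := by
    ext f x
    exact map_add (mvfderiv 𝓘(ℝ, E) f x) (X x) (Y x)
  map_smul' a X := by
    ext f x
    exact map_smul (mvfderiv 𝓘(ℝ, E) f x) (a x) (X x)

variable (g : ContMDiffRiemannianMetric 𝓘(ℝ, E) ∞ E (fun x : M => TangentSpace 𝓘(ℝ, E) x))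

/-- The metric as a bilinear form on smooth vector fields. -/
def smoothMetric : SmoothVF E M →ₗ[SmoothFun E M] SmoothVF E M →ₗ[SmoothFun E M] SmoothFun E M :=
  LinearMap.mk₂ (SmoothFun E M)
    (fun X Y => ⟨metric g X Y, X.isSmoothVF.metric Y.isSmoothVF g⟩)
    (fun X X' Y => by ext x; exact congrFun metric_add_left x)
    (fun a X Y => by ext x; exact congrFun (metric_smul_left (f := a)) x)
    (fun X Y Y' => by ext x; exact congrFun metric_add_right x)
    (fun a X Y => by ext x; exact congrFun (metric_smul_right (f := a)) x)

variable [FiniteDimensional ℝ E] [CompleteSpace E] [T2Space M]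

/-- The Levi-Civita connection on smooth vector fields. -/
def smoothConn : SmoothVF E M →ₗ[SmoothFun E M] SmoothVF E M →+ SmoothVF E M where
  toFun X :=
    { toFun := fun Y => ⟨nabla g X Y, X.isSmoothVF.nabla Y.isSmoothVF g⟩
      map_zero' := by
        ext x
        change leviCivita g 0 x (X x) = 0
        rw [CovariantDerivative.zero]
        rfl
      map_add' := fun Y Y' => by
        ext x
        change leviCivita g (⇑Y + ⇑Y') x (X x) = _
        rw [(leviCivita g).isCovariantDerivativeOnUniv.add (Y.mdifferentiableAt x)
          (Y'.mdifferentiableAt x)]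
        rfl }
  map_add' X X' := by
    ext Y x
    exact map_add (leviCivita g Y x) (X x) (X' x)
  map_smul' a X := by
    ext Y x
    exact map_smul (leviCivita g Y x) (a x) (X x)

lemma coe_smoothConn_sub (X Y : SmoothVF E M) :
    ⇑(smoothConn g X Y - smoothConn g Y X) = mlieBracket 𝓘(ℝ, E) X Y := by
  ext x
  exact leviCivita_torsion (X.mdifferentiableAt x) (Y.mdifferentiableAt x)

/-- The algebraic Levi-Civita calculus of a Riemannian manifold. -/
def leviCivitaCalculus : LeviCivitaCalculus (SmoothFun E M) (SmoothVF E M) where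
  D := smoothDeriv
  g := smoothMetric g
  conn := smoothConn g
  double_eq_zero f hf := by
    ext x
    rw [two_mul] at hf
    exact add_self_eq_zero.mp (congrArg (fun a : SmoothFun E M => a x) hf : f x + f x = 0)
  g_symm X Y := by
    ext x
    exact g.symm x _ _
  g_definite X hX := by
    ext x
    by_contra h
    have h1 := g.pos x (X x) h
    have h2 : g.inner x (X x) (X x) = 0 := congrArg (fun a : SmoothFun E M => a x) hX
    exact h1.ne' h2
  conn_smul X a Y := by
    ext x
    change leviCivita g (⇑a • ⇑Y) x (X x) = _
    rw [(leviCivita g).isCovariantDerivativeOnUniv.leibniz (Y.mdifferentiableAt x)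
      (a.mdifferentiableAt x)]
    rfl
  conn_metric X Y Z := by
    ext x
    exact leviCivita_metric (X.mdifferentiableAt x) (Y.mdifferentiableAt x) (Z.mdifferentiableAt x)
  jacobi X Y Z := by
    ext x
    simp only [ContMDiffSection.coe_add, Pi.add_apply, coe_smoothConn_sub]
    have hs (X : SmoothVF E M) :
        ContMDiffAt 𝓘(ℝ, E) (𝓘(ℝ, E).prod 𝓘(ℝ, E)) (minSmoothness ℝ 2) (T% fun y => X y) x :=
      (X.isSmoothVF x).of_le (by simpa using ENat.LEInfty.out)
    have : IsManifold 𝓘(ℝ, E) (minSmoothness ℝ 3) M :=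
      .of_le (n := ∞) (by simpa using ENat.LEInfty.out)
    have h := leibniz_identity_mlieBracket_apply (hs X) (hs Y) (hs Z)
    rw [h, mlieBracket_swap (V := Z) (W := X), mlieBracket_swap_apply (V := Z)]
    have hneg : mlieBracket 𝓘(ℝ, E) Y (-mlieBracket 𝓘(ℝ, E) X Z) x =
        -mlieBracket 𝓘(ℝ, E) Y (mlieBracket 𝓘(ℝ, E) X Z) x := by
      have := mlieBracket_const_smul_right (I := 𝓘(ℝ, E)) (V := Y) (c := (-1 : ℝ))
        ((X.isSmoothVF.mlieBracket Z.isSmoothVF).mdifferentiableAt x)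
      simpa using this
    rw [hneg]
    simp

end Calculus

namespace AlmostContactMetricStructure

variable {E : Type*} [NormedAddCommGroup E] [NormedSpace ℝ E]
  {M : Type*} [TopologicalSpace M] [ChartedSpace E M] [IsManifold 𝓘(ℝ, E) ∞ M]
  (S : AlmostContactMetricStructure E M)

/-- The action of `φ` on smooth vector fields. -/
def smoothφ : SmoothVF E M →ₗ[SmoothFun E M] SmoothVF E M where
  toFun X := ⟨fun x => S.φ x (X x),
    ContMDiff.clm_bundle_apply (F₁ := E) (F₂ := E) S.smooth_φ X.contMDiff⟩
  map_add' X Y := by ext x; exact map_add (S.φ x) (X x) (Y x)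
  map_smul' a X := by ext x; exact map_smul (S.φ x) (a x) (X x)

/-- The action of `η` on smooth vector fields. -/
def smoothη : SmoothVF E M →ₗ[SmoothFun E M] SmoothFun E M where
  toFun X := ⟨fun x => S.η x (X x), by
    have : ContMDiff 𝓘(ℝ, E) (𝓘(ℝ, E).prod 𝓘(ℝ)) ∞
        (fun m ↦ TotalSpace.mk' ℝ (E := Bundle.Trivial M ℝ) m (S.η m (X m))) :=
      ContMDiff.clm_bundle_apply (F₁ := E) (F₂ := ℝ) S.smooth_η X.contMDiff
    exact fun x => (contMDiffAt_totalSpace.mp (this x)).2⟩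
  map_add' X Y := by ext x; exact map_add (S.η x) (X x) (Y x)
  map_smul' a X := by ext x; exact map_smul (S.η x) (a x) (X x)

variable [FiniteDimensional ℝ E] [CompleteSpace E] [T2Space M]

/-- The algebraic calculus of an almost cosymplectic manifold. -/
def calculus {α : ℝ} (hS : S.IsAlmostCosymplectic α) :
    AlmostCosymplecticCalculus (SmoothFun E M) (SmoothVF E M) where
  toLeviCivitaCalculus := leviCivitaCalculus S.g
  φ := S.smoothφ
  ξ := ⟨S.ξ, S.smooth_ξ⟩
  η := S.smoothη
  α := ⟨fun _ => α, contMDiff_const⟩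
  D_α X := by
    ext x
    change mvfderiv 𝓘(ℝ, E) (fun _ => α) x (X x) = 0
    rw [mvfderiv_const]
    rfl
  φ_sq X := by ext x; exact S.φ_sq x (X x)
  η_ξ := by ext x; exact S.η_ξ x
  compatible X Y := by ext x; exact S.compatible x (X x) (Y x)
  dη_eq X Y := by
    ext x
    have h := hS.1 X Y X.isSmoothVF Y.isSmoothVF x
    rw [extDerivOne, ← coe_smoothConn_sub S.g] at h
    exact h
  dΦ_eq X Y Z := by
    ext x
    have h := hS.2 X Y Z X.isSmoothVF Y.isSmoothVF Z.isSmoothVF x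
    rw [extDerivTwo, ← coe_smoothConn_sub S.g, ← coe_smoothConn_sub S.g,
      ← coe_smoothConn_sub S.g, ← SmoothFun.two_apply (E := E) x] at h
    exact h

variable {S} {α : ℝ} (hS : S.IsAlmostCosymplectic α)

lemma calculus_bracket (X Y : SmoothVF E M) :
    ⇑((S.calculus hS).bracket X Y) = mlieBracket 𝓘(ℝ, E) X Y :=
  coe_smoothConn_sub S.g X Y

lemma h_eq (X : SmoothVF E M) (x : M) :
    S.h x (X x) = (S.calculus hS).φ ((S.calculus hS).tracefree X) x := by
  have h1 := S.h_apply (X.mdifferentiableAt x)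
  have h2 := congrArg (fun Y : SmoothVF E M => Y x) ((S.calculus hS).bracket_φ X)
  simp only [ContMDiffSection.coe_sub, Pi.sub_apply, calculus_bracket] at h2
  have h3 : S.lieDerivPhi X x = (2 : ℝ) • (S.calculus hS).φ ((S.calculus hS).tracefree X) x := by
    have e : S.lieDerivPhi X x = mlieBracket 𝓘(ℝ, E) S.ξ (S.smoothφ X) x -
        S.φ x ((S.calculus hS).bracket (S.calculus hS).ξ X x) := by
      rw [calculus_bracket]
      rfl
    rw [← SmoothFun.two_apply (E := E) x, e]
    exact h2
  rw [h1, h3, smul_smul]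
  norm_num

lemma tracefree_eq (X : SmoothVF E M) (x : M) :
    (S.calculus hS).tracefree X x = -S.φ x (S.h x (X x)) := by
  have h := congrArg (fun Y : SmoothVF E M => Y x)
    ((S.calculus hS).φ_sq ((S.calculus hS).tracefree X))
  rw [AlmostCosymplecticCalculus.η_tracefree, zero_smul, add_zero] at h
  rw [h_eq hS]
  exact (neg_eq_iff_eq_neg.mpr h).symm

lemma nullity {κ μ ν : SmoothFun E M} (hR : S.NullityCondition κ μ ν) :
    (S.calculus hS).Nullity κ μ ν := by
  intro X Y
  ext x
  have h := hR X Y X.isSmoothVF Y.isSmoothVF x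
  have h1 : (S.calculus hS).curv X Y (S.calculus hS).ξ x = curvature S.g X Y S.ξ x := by
    have e : smoothConn S.g ((S.calculus hS).bracket X Y) (S.calculus hS).ξ x =
        nabla S.g (mlieBracket 𝓘(ℝ, E) X Y) S.ξ x := by
      rw [← calculus_bracket hS]
      rfl
    change _ - _ - smoothConn S.g ((S.calculus hS).bracket X Y) (S.calculus hS).ξ x = _
    rw [e]
    rfl
  have e (Z : SmoothVF E M) : S.φ x (S.h x (Z x)) = -(S.calculus hS).tracefree Z x := by
    rw [tracefree_eq hS, neg_neg]
  rw [h1, h, e, e, h_eq hS, h_eq hS]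
  simp only [smul_neg, ← sub_eq_add_neg]
  rfl

end AlmostContactMetricStructure

/-! ### The differential of `κ` -/

/-- The trace over `v` of the identity `h` is `(3 - dim V) ℓ (B u) = 0`, because `B` anticommutes
with `φ` and so has trace zero. -/
lemma linearForm_comp_eq_zero {V : Type*} [AddCommGroup V] [Module ℝ V] [FiniteDimensional ℝ V]
    (hdim : Module.finrank ℝ V ≠ 3) {φ B : V →ₗ[ℝ] V} {ξ : V} {η ℓ : V →ₗ[ℝ] ℝ} (hη : η ξ = 1)
    (hφ : ∀ v, φ (φ v) = -v + η v • ξ) (hBφ : ∀ v, φ (B v) = -B (φ v)) (hBξ : B ξ = 0)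
    (hηB : ∀ v, η (B v) = 0)
    (h : ∀ u v, η u = 0 → η v = 0 →
      ℓ v • B u - ℓ u • B v - ℓ (B u) • v + ℓ (B v) • u = 0)
    {u : V} (hu : η u = 0) : ℓ (B u) = 0 := by
  let P : V →ₗ[ℝ] V := LinearMap.id - η.smulRight ξ
  have hP (v) : P v = v - η v • ξ := by simp [P]
  have htrB : LinearMap.trace ℝ V B = 0 := by
    have h1 : φ * (φ * B) = -B := by
      ext v
      simp [hφ, hηB]
    have h2 : (φ * B) * φ = B := by
      ext v
      simp [hBφ, hφ, hBξ]
    have h3 := LinearMap.trace_mul_comm ℝ φ (φ * B)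
    rw [h1, h2, map_neg] at h3
    linarith
  have hT : (ℓ ∘ₗ P).smulRight (B u) - ℓ u • B - ℓ (B u) • P + (ℓ ∘ₗ B).smulRight u = 0 := by
    ext v
    have h1 := h u (P v) hu (by simp [hP, hη])
    have h2 : B (P v) = B v := by simp [hP, hBξ]
    rw [h2] at h1
    simpa using h1
  have htr := congrArg (LinearMap.trace ℝ V) hT
  simp only [map_add, map_sub, map_smul, LinearMap.trace_smulRight, htrB, LinearMap.comp_apply, P,
    LinearMap.trace_id, LinearMap.sub_apply, LinearMap.id_apply, LinearMap.smulRight_apply, hηB, hη,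
    zero_smul, sub_zero, map_zero, smul_eq_mul] at htr
  have h3 : (3 - (Module.finrank ℝ V : ℝ)) * ℓ (B u) = 0 := by linarith
  rcases mul_eq_zero.mp h3 with h4 | h4
  · exact absurd (by exact_mod_cast (sub_eq_zero.mp h4).symm) hdim
  · exact h4

section

variable {E : Type*} [NormedAddCommGroup E] [NormedSpace ℝ E] [FiniteDimensional ℝ E]
  [CompleteSpace E] {M : Type*} [TopologicalSpace M] [ChartedSpace E M]
  [IsManifold 𝓘(ℝ, E) ∞ M] [T2Space M]

omit [CompleteSpace E] in
lemma exists_smoothVF_apply_eq {p : M} (v : TangentSpace 𝓘(ℝ, E) p) :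
    ∃ X : SmoothVF E M, X p = v :=
  let ⟨Y, hY, hp⟩ := exists_isSmoothVF_apply_eq v
  ⟨⟨Y, hY⟩, hp⟩

namespace AlmostContactMetricStructure

variable {S : AlmostContactMetricStructure E M} {α : ℝ} (hS : S.IsAlmostCosymplectic α)

lemma exists_horizontal_apply_eq {p : M} {v : TangentSpace 𝓘(ℝ, E) p} (hv : S.η p v = 0) :
    ∃ X : SmoothVF E M, (S.calculus hS).η X = 0 ∧ X p = v := by
  obtain ⟨X, rfl⟩ := exists_smoothVF_apply_eq v
  refine ⟨X - (S.calculus hS).η X • (S.calculus hS).ξ, ?_, ?_⟩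
  · simp [(S.calculus hS).η_ξ]
  · change X p - S.η p (X p) • S.ξ p = X p
    rw [hv, zero_smul, sub_zero]

omit [CompleteSpace E] [T2Space M] in
lemma exists_horizontal_ne_zero (hdim : 1 < Module.finrank ℝ E) (p : M) :
    ∃ v : TangentSpace 𝓘(ℝ, E) p, S.η p v = 0 ∧ v ≠ 0 := by
  have : FiniteDimensional ℝ (TangentSpace 𝓘(ℝ, E) p) := inferInstanceAs (FiniteDimensional ℝ E)
  have h : LinearMap.ker (S.η p).toLinearMap ≠ ⊥ := by
    apply LinearMap.ker_ne_bot_of_finrank_lt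
    rw [Module.finrank_self]
    exact hdim
  obtain ⟨v, hv, hv0⟩ := Submodule.exists_mem_ne_zero_of_ne_bot h
  exact ⟨v, hv, hv0⟩

/-- A function annihilating the length of all horizontal vector fields is zero. -/
lemma eq_zero_of_mul_g_self (hdim : 1 < Module.finrank ℝ E) {f : SmoothFun E M} {p : M}
    (hf : ∀ Y, (S.calculus hS).η Y = 0 → (f * (S.calculus hS).g Y Y) p = 0) : f p = 0 := by
  obtain ⟨v, hv, hv0⟩ := S.exists_horizontal_ne_zero hdim p
  obtain ⟨Y, hY, rfl⟩ := exists_horizontal_apply_eq hS hv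
  exact (mul_eq_zero.mp (hf Y hY)).resolve_right (S.g.pos p _ hv0).ne'

variable {κ μ ν : SmoothFun E M} (hR : S.NullityCondition κ μ ν)

include hR in
lemma D_κ_eq_zero (hdim : 3 < Module.finrank ℝ E) (X : SmoothVF E M)
    (hX : (S.calculus hS).η X = 0) : (S.calculus hS).D X κ = 0 := by
  let C := S.calculus hS
  have hN : AlmostCosymplecticCalculus.Nullity C κ μ ν := nullity hS hR
  ext p
  have ev {f f' : SmoothFun E M} (h : f = f') : f p = f' p := by rw [h]
  by_cases hσ : (C.α ^ 2 + κ) p = 0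
  · -- `B` vanishes at `p`
    refine eq_zero_of_mul_g_self hS (by omega) fun Y hY => ?_
    have h1 := ev (hN.g_tracefree_self hY)
    have h2 := ev (hN.D_mul_g_self_of_tracefree X hY)
    have h3 : C.tracefree Y p = 0 := by
      by_contra hne
      refine (S.g.pos p _ hne).ne' ?_
      refine Eq.trans h1 ?_
      change -((C.α ^ 2 + κ) p) * _ = _
      rw [hσ]
      simp
    have h4 : C.g (C.conn X (C.tracefree Y)) (C.tracefree Y) p = 0 := by
      change S.g.inner p _ (C.tracefree Y p) = 0
      rw [h3, map_zero]
    simp only [ContMDiffMap.coe_add, ContMDiffMap.coe_mul, ContMDiffMap.coe_neg, Pi.add_apply,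
      Pi.mul_apply, Pi.neg_apply, h4] at h2 hσ ⊢
    rw [hσ] at h2
    linear_combination -h2
  · have : FiniteDimensional ℝ (TangentSpace 𝓘(ℝ, E) p) := inferInstanceAs (FiniteDimensional ℝ E)
    let B : TangentSpace 𝓘(ℝ, E) p →L[ℝ] TangentSpace 𝓘(ℝ, E) p := -(S.φ p ∘L S.h p)
    have hB (X : SmoothVF E M) : C.tracefree X p = B (X p) := tracefree_eq hS X p
    have key : mvfderiv 𝓘(ℝ, E) κ p (B (C.tracefree X p)) = 0 := by
      have hdim' : Module.finrank ℝ (TangentSpace 𝓘(ℝ, E) p) ≠ 3 := hdim.ne'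
      refine linearForm_comp_eq_zero hdim' (φ := (S.φ p).toLinearMap) (B := B.toLinearMap)
        (ξ := S.ξ p) (η := (S.η p).toLinearMap) (ℓ := (mvfderiv 𝓘(ℝ, E) κ p).toLinearMap)
        (S.η_ξ p) (S.φ_sq p) ?_ ?_ ?_ ?_ ?_
      · intro v
        obtain ⟨V, rfl⟩ := exists_smoothVF_apply_eq v
        have h := congrArg (fun W : SmoothVF E M => W p) (C.φ_tracefree V)
        change S.φ p (B (V p)) = -B (S.φ p (V p))
        rw [← hB V]
        refine h.trans ?_
        change -C.tracefree (C.φ V) p = _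
        rw [hB]
        rfl
      · have h := congrArg (fun W : SmoothVF E M => W p) C.tracefree_ξ
        exact (hB C.ξ).symm.trans h
      · intro v
        obtain ⟨V, rfl⟩ := exists_smoothVF_apply_eq v
        have h := ev (C.η_tracefree V)
        change S.η p (B (V p)) = 0
        rw [← hB V]
        exact h
      · intro u v hu hv
        obtain ⟨U, hU, rfl⟩ := exists_horizontal_apply_eq hS hu
        obtain ⟨V, hV, rfl⟩ := exists_horizontal_apply_eq hS hv
        change C.η U = 0 at hU
        change C.η V = 0 at hV
        change _ • B (U p) - _ • B (V p) - mvfderiv 𝓘(ℝ, E) κ p (B (U p)) • _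
          + mvfderiv 𝓘(ℝ, E) κ p (B (V p)) • _ = 0
        rw [← hB, ← hB]
        have h : C.D V κ • C.tracefree U - C.D U κ • C.tracefree V - C.D (C.tracefree U) κ • V
            + C.D (C.tracefree V) κ • U = 0 := by
          apply C.g_definite
          have hW := hN.D_sigma_identity hU hV
            (Z := C.D V κ • C.tracefree U - C.D U κ • C.tracefree V - C.D (C.tracefree U) κ • V
              + C.D (C.tracefree V) κ • U) (by simp [C.η_tracefree, hU, hV])
          simpa using hW
        exact congrArg (fun W : SmoothVF E M => W p) h
      · exact ev (C.η_tracefree X)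
    rw [← hB, hN.tracefree_sq hX] at key
    replace key : -((C.α ^ 2 + κ) p) * C.D X κ p = 0 :=
      (map_smul (mvfderiv 𝓘(ℝ, E) κ p) _ _).symm.trans key
    exact (mul_eq_zero.mp key).resolve_left (neg_ne_zero.mpr hσ)

end AlmostContactMetricStructure

end

/-! ### Zeros of functions with `df = f θ` -/

section

variable {E : Type*} [NormedAddCommGroup E] [NormedSpace ℝ E]
  {M : Type*} [TopologicalSpace M] [ChartedSpace E M] [IsManifold 𝓘(ℝ, E) ∞ M]

/-- If `df = f c θ` for a function `c` and a 1-form `θ`, the zero set of `f` is open: along the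
segments issuing from a zero of `f` in a chart, `f` solves a linear differential equation. -/
lemma isOpen_setOf_eq_zero {f c : SmoothFun E M} {θ : Π x : M, TangentSpace 𝓘(ℝ, E) x →L[ℝ] ℝ}
    (hθ : ContMDiff 𝓘(ℝ, E) (𝓘(ℝ, E).prod 𝓘(ℝ, E →L[ℝ] ℝ)) ∞
      (fun x => TotalSpace.mk' (E →L[ℝ] ℝ)
        (E := fun x : M => TangentSpace 𝓘(ℝ, E) x →L[ℝ] Bundle.Trivial M ℝ x) x (θ x)))
    (hf : ∀ x v, mvfderiv 𝓘(ℝ, E) f x v = c x * θ x v * f x) : IsOpen {x | f x = 0} := by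
  rw [isOpen_iff_mem_nhds]
  intro p hp
  let φ := extChartAt 𝓘(ℝ, E) p
  let e := trivializationAt E (TangentSpace 𝓘(ℝ, E)) p
  obtain ⟨r, hr, hball⟩ := Metric.isOpen_iff.mp (isOpen_extChartAt_target (I := 𝓘(ℝ, E)) p) (φ p)
    (mem_extChartAt_target p)
  have hzero : ∀ y ∈ Metric.ball (φ p) r, f (φ.symm y) = 0 := by
    intro y hy
    let w := y - φ p
    let l (t : ℝ) : E := φ p + t • w
    have hl (t : ℝ) (ht : t ∈ Set.Icc (0 : ℝ) 1) : l t ∈ φ.target := by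
      apply hball
      have := (convex_ball (φ p) r).add_smul_sub_mem (Metric.mem_ball_self hr) hy ht
      exact this
    let W (x : M) : TangentSpace 𝓘(ℝ, E) x := e.symmL ℝ x w
    have hW : ContMDiffOn 𝓘(ℝ, E) (𝓘(ℝ, E).prod 𝓘(ℝ, E)) ∞ (T% W) e.baseSet := by
      rw [e.contMDiffOn_section_baseSet_iff]
      refine (contMDiffOn_const (c := w)).congr fun x hx => ?_
      simp [W, hx]
    have hθW : ContinuousOn (fun x => θ x (W x)) e.baseSet := by
      have h1 : ContMDiffOn 𝓘(ℝ, E) (𝓘(ℝ, E).prod 𝓘(ℝ)) ∞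
          (fun m ↦ TotalSpace.mk' ℝ (E := Bundle.Trivial M ℝ) m (θ m (W m))) e.baseSet :=
        ContMDiffOn.clm_bundle_apply (F₁ := E) (F₂ := ℝ) hθ.contMDiffOn hW
      exact fun x hx => (contMDiffWithinAt_totalSpace.mp (h1 x hx)).2.continuousWithinAt
    let γ (t : ℝ) : M := φ.symm (l t)
    have hγs (t) (ht : t ∈ Set.Icc (0 : ℝ) 1) : γ t ∈ (chartAt E p).source := by
      have := φ.map_target (hl t ht)
      rwa [extChartAt_source] at this
    have hl_cont : Continuous l := by fun_prop
    have hγ : ContinuousOn γ (Set.Icc 0 1) :=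
      (continuousOn_extChartAt_symm p).comp hl_cont.continuousOn hl
    have hder (t) (ht : t ∈ Set.Icc (0 : ℝ) 1) :
        HasDerivAt (fun t => f (γ t)) (mvfderiv 𝓘(ℝ, E) f (γ t) (W (γ t))) t := by
      have h1 : HasMFDerivAt 𝓘(ℝ, E) 𝓘(ℝ, ℝ) f (γ t) (mfderiv 𝓘(ℝ, E) 𝓘(ℝ, ℝ) f (γ t)) :=
        (f.mdifferentiableAt _).hasMFDerivAt
      have h2 : HasMFDerivAt 𝓘(ℝ, E) 𝓘(ℝ, E) φ.symm (l t)
          (mfderiv 𝓘(ℝ, E) 𝓘(ℝ, E) φ.symm (l t)) := by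
        have h := mdifferentiableWithinAt_extChartAt_symm (hl t ht)
        rw [modelWithCornersSelf_coe, Set.range_id, mdifferentiableWithinAt_univ] at h
        exact h.hasMFDerivAt
      have h3 := (HasMFDerivAt.comp (l t) h1 h2).hasFDerivAt
      have h4 : HasDerivAt l w t := by
        simpa [l] using ((hasDerivAt_id t).smul_const w).const_add (φ p)
      have h5 := h3.comp_hasDerivAt t h4
      have h6 : W (γ t) = mfderiv 𝓘(ℝ, E) 𝓘(ℝ, E) φ.symm (l t) w := by
        have := TangentBundle.symmL_trivializationAt (I := 𝓘(ℝ, E)) (hγs t ht)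
        rw [modelWithCornersSelf_coe, Set.range_id, mfderivWithin_univ,
          φ.right_inv (hl t ht)] at this
        exact congrArg (fun T => T w) this
      rw [h6]
      exact h5
    obtain ⟨K, hK⟩ := isCompact_Icc.exists_bound_of_continuousOn
      ((c.contMDiff.continuous.comp_continuousOn hγ).mul (hθW.comp hγ hγs))
    have hres := eq_zero_of_abs_deriv_le_mul_abs_self_of_eq_zero_right (f := fun t => f (γ t))
      (K := K) (a := 0) (b := 1)
      (fun t ht => (hder t ht).continuousAt.continuousWithinAt)
      (fun t ht => (hder t (Set.Ico_subset_Icc_self ht)).hasDerivWithinAt)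
      (by simpa [γ, l, φ] using hp)
      (fun t ht => by
        rw [hf, norm_mul]
        exact mul_le_mul_of_nonneg_right (hK t (Set.Ico_subset_Icc_self ht)) (norm_nonneg _))
      1 (by simp)
    simpa [γ, l, w] using hres
  filter_upwards [(continuousAt_extChartAt (I := 𝓘(ℝ, E)) p).preimage_mem_nhds
    (Metric.ball_mem_nhds _ hr), extChartAt_source_mem_nhds (I := 𝓘(ℝ, E)) p] with x hx hx'
  have := hzero _ hx
  rwa [φ.left_inv hx'] at this

end

namespace AlmostContactMetricStructure

/-! ### Constancy of `κ`, `μ`, `ν` along the leaves -/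

variable {E : Type*} [NormedAddCommGroup E] [NormedSpace ℝ E] [FiniteDimensional ℝ E]
  [CompleteSpace E] {M : Type*} [TopologicalSpace M] [ChartedSpace E M]
  [IsManifold 𝓘(ℝ, E) ∞ M] [T2Space M]
  {S : AlmostContactMetricStructure E M} {α : ℝ} (hS : S.IsAlmostCosymplectic α)

include hS in
lemma mem_etaRing_of_D_eq_zero {f : SmoothFun E M}
    (hf : ∀ X, (S.calculus hS).η X = 0 → (S.calculus hS).D X f = 0) : f ∈ etaRing S.η := by
  intro x u v
  have key (u : TangentSpace 𝓘(ℝ, E) x) :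
      mvfderiv 𝓘(ℝ, E) f x u = S.η x u * mvfderiv 𝓘(ℝ, E) f x (S.ξ x) := by
    have hu : S.η x (u - S.η x u • S.ξ x) = 0 := by
      rw [map_sub, map_smul, S.η_ξ, smul_eq_mul, mul_one, sub_self]
    obtain ⟨X, hX, hXx⟩ := exists_horizontal_apply_eq hS hu
    have h : mvfderiv 𝓘(ℝ, E) f x (X x) = 0 := congrArg (fun a : SmoothFun E M => a x) (hf X hX)
    rw [hXx, map_sub, map_smul, smul_eq_mul] at h
    linarith
  rw [wedgeOneOne, key u, key v]
  ring

variable {κ μ ν : SmoothFun E M} (hR : S.NullityCondition κ μ ν)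

include hR in
lemma D_κ_eq (hdim : 3 < Module.finrank ℝ E) (X : SmoothVF E M) :
    (S.calculus hS).D X κ = 2 * (ν - 2 * (S.calculus hS).α) * (S.calculus hS).η X
      * ((S.calculus hS).α ^ 2 + κ) := by
  set C := S.calculus hS with hC
  have hN : AlmostCosymplecticCalculus.Nullity C κ μ ν := nullity hS hR
  have h1 : C.D (X - C.η X • C.ξ) κ = 0 :=
    D_κ_eq_zero hS hR hdim _ (by simp [← hC, C.η_ξ])
  have h2 : C.D C.ξ κ - 2 * (ν - 2 * C.α) * (C.α ^ 2 + κ) = 0 := by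
    ext p
    refine eq_zero_of_mul_g_self hS (by omega) fun Y hY => ?_
    have h := hN.D_ξ_mul_g_self hY
    have h' : (C.D C.ξ κ - 2 * (ν - 2 * C.α) * (C.α ^ 2 + κ)) * C.g Y Y = 0 := by
      linear_combination h
    exact congrArg (fun a : SmoothFun E M => a p) h'
  simp only [map_sub, map_smul, Derivation.sub_apply, Derivation.smul_apply, smul_eq_mul] at h1
  linear_combination h1 + C.η X * h2

include hS hR in
/-- Under the nullity condition, `σ = -(κ + α²)` vanishes nowhere on a component on which `h` does
not vanish identically. -/
lemma alpha_sq_add_kappa_ne_zero (hdim : 3 < Module.finrank ℝ E) {p q : M}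
    (hq : q ∈ connectedComponent p) (hh : S.h q ≠ 0) : α ^ 2 + κ p ≠ 0 := by
  set C := S.calculus hS with hC
  have hN : AlmostCosymplecticCalculus.Nullity C κ μ ν := nullity hS hR
  let f : SmoothFun E M := C.α ^ 2 + κ
  have hfx (x) : f x = α ^ 2 + κ x := by
    simp only [f, pow_two]
    rfl
  have hopen : IsOpen {x | f x = 0} := by
    refine isOpen_setOf_eq_zero (c := 2 * (ν - 2 * C.α)) S.smooth_η fun x v => ?_
    obtain ⟨X, rfl⟩ := exists_smoothVF_apply_eq v
    have h : C.D X f = 2 * (ν - 2 * C.α) * C.η X * f := by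
      rw [← D_κ_eq hS hR hdim]
      simp [f, pow_two, C.D_mul, C.D_α, ← hC]
    exact congrArg (fun a : SmoothFun E M => a x) h
  have hclopen : IsClopen {x | f x = 0} :=
    ⟨isClosed_singleton.preimage f.contMDiff.continuous, hopen⟩
  intro h0
  have hfq : f q = 0 := hclopen.connectedComponent_subset ((hfx p).trans h0) hq
  apply hh
  ext v
  obtain ⟨X, rfl⟩ := exists_smoothVF_apply_eq v
  have hB : C.tracefree X q = 0 := by
    -- `B` depends only on the horizontal part of its argument
    have h1 := hN.g_tracefree_self (Y := X - C.η X • C.ξ) (by simp [C.η_ξ])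
    rw [map_sub, map_smul, C.tracefree_ξ, smul_zero, sub_zero] at h1
    have h2 := congrArg (fun a : SmoothFun E M => a q) h1
    by_contra hne
    refine (S.g.pos q _ hne).ne' (Eq.trans h2 ?_)
    change -(f q) * _ = 0
    rw [hfq, neg_zero, zero_mul]
  rw [h_eq hS]
  change S.φ q (C.tracefree X q) = 0
  rw [hB, map_zero]

include hS hR in
/-- The conclusion in any dimension greater than three. -/
theorem mem_etaRing_of_nullity (hdim : 3 < Module.finrank ℝ E) :
    κ ∈ etaRing S.η ∧
    ((∀ p : M, ∃ q ∈ connectedComponent p, S.h q ≠ 0) → μ ∈ etaRing S.η ∧ ν ∈ etaRing S.η) := by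
  have hκ := D_κ_eq_zero hS hR hdim
  refine ⟨mem_etaRing_of_D_eq_zero hS hκ, fun hh => ?_⟩
  set C := S.calculus hS with hC
  have hN : AlmostCosymplecticCalculus.Nullity C κ μ ν := nullity hS hR
  have hσ (a : SmoothFun E M) (ha : (C.α ^ 2 + κ) * a = 0) : a = 0 := by
    ext p
    obtain ⟨q, hq, hhq⟩ := hh p
    have h1 := congrArg (fun a : SmoothFun E M => a p) ha
    rw [pow_two] at h1
    replace h1 : (α * α + κ p) * a p = 0 := h1
    rw [← pow_two] at h1
    exact (mul_eq_zero.mp h1).resolve_left (alpha_sq_add_kappa_ne_zero hS hR hdim hq hhq)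
  have h (X) (hX : C.η X = 0) : C.D X μ = 0 ∧ C.D X ν = 0 := by
    constructor <;> ext p <;> refine eq_zero_of_mul_g_self hS (by omega) fun Y hY => ?_
    · exact congrArg (fun a : SmoothFun E M => a p) (hN.D_mul_g_self hσ hκ hX hY).1
    · exact congrArg (fun a : SmoothFun E M => a p) (hN.D_mul_g_self hσ hκ hX hY).2
  exact ⟨mem_etaRing_of_D_eq_zero hS fun X hX => (h X hX).1,
    mem_etaRing_of_D_eq_zero hS fun X hX => (h X hX).2⟩

end AlmostContactMetricStructure

end AlmostCosymplectic

theorem mainTheorem1 (n : ℕ) (hn : 3 < 2 * n + 1)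
    {M : Type*} [TopologicalSpace M] [T2Space M] [SecondCountableTopology M]
    [ChartedSpace (EuclideanSpace ℝ (Fin (2 * n + 1))) M]
    [IsManifold 𝓘(ℝ, EuclideanSpace ℝ (Fin (2 * n + 1))) ∞ M]
    (α : ℝ)
    (S : AlmostCosymplectic.AlmostContactMetricStructure (EuclideanSpace ℝ (Fin (2 * n + 1))) M)
    (hS : S.IsAlmostCosymplectic α)
    (κ μ ν : C^∞⟮𝓘(ℝ, EuclideanSpace ℝ (Fin (2 * n + 1))), M; 𝓘(ℝ, ℝ), ℝ⟯)
    (hR : S.NullityCondition κ μ ν) :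
    κ ∈ AlmostCosymplectic.etaRing S.η ∧
    ((∀ p : M, ∃ q ∈ connectedComponent p, S.h q ≠ 0) →
      μ ∈ AlmostCosymplectic.etaRing S.η ∧ ν ∈ AlmostCosymplectic.etaRing S.η) :=
  AlmostCosymplectic.AlmostContactMetricStructure.mem_etaRing_of_nullity hS hR (by simpa using hn)
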